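/- Let $d\ge 0$ be an integer and let $\mathbb{R}^d$ carry its Euclidean inner product. A closed convex cone is a nonempty closed set $C\subseteq\mathbb{R}^d$ with $\tau(x+y)\in C$ for all $x,y\in C$ and $\tau>0$; its polar cone is $C^\circ=\{u:\langle u,x\rangle\le 0\text{ for all }x\in C\}$, and $\Pi_C(x)$ denotes the point of $C$ nearest to $x$. A cone is polyhedral if it is an intersection of finitely many halfspaces $\{x:\langle u_i,x\rangle\ge 0\}$; a face of $C$ is a nonempty set of the form $\{x\in C:\langle u,x\rangle=\sup_{y\in C}\langle u,y\rangle\}$ with $u\in\mathbb{R}^d$, and the dimension of a face is the dimension of its linear hull. For a polyhedral cone $C$ and $k=0,\dots,d$, let $$v_k(C)=\mathbb{P}\{\Pi_C(g)\text{ lies in the relative interior of a }k\text{-dimensional face of }C\},$$ where $g$ is a standard Gaussian vector in $\mathbb{R}^d$. For a general closed convex cone $C$ let $v_k(C)=\lim_{i\to\infty}v_k(C_i)$, where $(C_i)$ is any sequence of polyhedral cones that converges to $C$ in the conic Hausdorff metric $$\operatorname{dist}_H(C_1,C_2)=\inf\{\alpha\ge 0: C_2\subseteq T(C_1,\alpha)\text{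 and }C_1\subseteq T(C_2,\alpha)\}.$$ Here $T(C,\alpha)$ is the set of all $x$ such that some $y\in C$ has angle at most $\alpha$ with $x$ (the angle between $0$ and $0$ is $0$, and that between $0$ and a nonzero vector is $\pi/2$). **Theorem (variance bound for intrinsic volumes).** Let $C\subseteq\mathbb{R}^d$ be a closed convex cone. Then the numbers $v_k(C)$ are well defined (there is a sequence of polyhedral cones that converges to $C$, and for every such sequence and every $k$ the limit exists and has the same value), and they form a probability distribution on $\{0,\dots,d\}$. If $V_C$ is a random variable with $\mathbb{P}\{V_C=k\}=v_k(C)$ for $k=0,\dots,d$, and $\delta(C)=\mathbb{E}[V_C]=\sum_{k=0}^d k\,v_k(C)$ is the statistical dimension of $C$, then $$\operatorname{Var}[V_C]\le 2\min\{\delta(C),\delta(C^\circ)\}.$$ -/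

import Mathlib

open MeasureTheory ProbabilityTheory Filter Topology
open scoped RealInnerProductSpace

/-
The space `ℝ^d` is `EuclideanSpace ℝ (Fin d)`, and the family of all closed convex cones in `ℝ^d`
is `ProperCone ℝ (EuclideanSpace ℝ (Fin d))`: nonempty closed sets that are stable under sums and
under multiplication by nonnegative reals (a nonempty closed convex cone always contains `0`).
-/

namespace ConicGeometry

noncomputable section

/-- A cone is polyhedral if it is an intersection of finitely many halfspaces
`{x | ⟪u i, x⟫ ≥ 0}`. -/
def IsPolyhedral {d : ℕ} (C : ProperCone ℝ (EuclideanSpace ℝ (Fin d))) : Prop :=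
  ∃ (N : ℕ) (u : Fin N → EuclideanSpace ℝ (Fin d)),
    (C : Set (EuclideanSpace ℝ (Fin d))) = ⋂ i, {x | 0 ≤ ⟪u i, x⟫}

/-- The polar cone `{u | ⟪u, x⟫ ≤ 0 for all x ∈ C}`. -/
def polarCone {d : ℕ} (C : ProperCone ℝ (EuclideanSpace ℝ (Fin d))) :
    ProperCone ℝ (EuclideanSpace ℝ (Fin d)) :=
  ProperCone.innerDual {x | -x ∈ C}

theorem mem_polarCone {d : ℕ} (C : ProperCone ℝ (EuclideanSpace ℝ (Fin d)))
    (u : EuclideanSpace ℝ (Fin d)) :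
    u ∈ polarCone C ↔ ∀ x ∈ C, ⟪u, x⟫ ≤ 0 := by
  unfold polarCone
  rw [ProperCone.mem_innerDual]
  constructor
  · intro h x hx
    have h1 := h (x := -x) (by simpa using hx)
    rw [inner_neg_left, real_inner_comm] at h1
    linarith
  · intro h x hx
    have h1 := h (-x) hx
    rw [inner_neg_right, real_inner_comm] at h1
    linarith

/-- A closed convex cone contains a unique point nearest to a given point `x`. -/
theorem existsUnique_nearest {d : ℕ} (C : ProperCone ℝ (EuclideanSpace ℝ (Fin d)))
    (x : EuclideanSpace ℝ (Fin d)) :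
    ∃! y, y ∈ C ∧ ∀ z ∈ C, ‖x - y‖ ≤ ‖x - z‖ := by
  have hconv : Convex ℝ (C : Set (EuclideanSpace ℝ (Fin d))) := by
    intro a ha b hb s t hs ht _
    exact add_mem (C.smul_mem ha hs) (C.smul_mem hb ht)
  have key : ∀ y ∈ C, (∀ z ∈ C, ‖x - y‖ ≤ ‖x - z‖) → ∀ w ∈ C, ⟪x - y, w - y⟫ ≤ 0 := by
    intro y hy hmin
    refine (norm_eq_iInf_iff_real_inner_le_zero hconv hy).1 (le_antisymm ?_ ?_)
    · have : Nonempty (C : Set (EuclideanSpace ℝ (Fin d))) := ⟨⟨y, hy⟩⟩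
      exact le_ciInf fun w => hmin w w.2
    · exact ciInf_le (f := fun w : (C : Set (EuclideanSpace ℝ (Fin d))) => ‖x - w‖)
        ⟨0, Set.forall_mem_range.2 fun _ => norm_nonneg _⟩ ⟨y, hy⟩
  obtain ⟨y, hy, hmin⟩ :=
    exists_norm_eq_iInf_of_complete_convex C.nonempty C.isClosed.isComplete hconv x
  refine ⟨y, ⟨hy, fun z hz => ?_⟩, ?_⟩
  · rw [hmin]
    exact ciInf_le (f := fun w : (C : Set (EuclideanSpace ℝ (Fin d))) => ‖x - w‖)
      ⟨0, Set.forall_mem_range.2 fun _ => norm_nonneg _⟩ ⟨z, hz⟩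
  · rintro y' ⟨hy', hmin'⟩
    have hmin2 : ∀ z ∈ C, ‖x - y‖ ≤ ‖x - z‖ := fun z hz => by
      rw [hmin]
      exact ciInf_le (f := fun w : (C : Set (EuclideanSpace ℝ (Fin d))) => ‖x - w‖)
        ⟨0, Set.forall_mem_range.2 fun _ => norm_nonneg _⟩ ⟨z, hz⟩
    have h1 := key y hy hmin2 y' hy'
    have h2 := key y' hy' hmin' y hy
    have h3 : ⟪y' - y, y' - y⟫ ≤ 0 := by
      have : y' - y = (x - y) - (x - y') := by abel
      calc ⟪y' - y, y' - y⟫ = ⟪(x - y) - (x - y'), y' - y⟫ := by rw [← this]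
        _ = ⟪x - y, y' - y⟫ + ⟪x - y', y - y'⟫ := by
            rw [inner_sub_left, ← neg_sub y' y, inner_neg_right]; ring
        _ ≤ 0 := by linarith
    exact sub_eq_zero.1 (inner_self_eq_zero (𝕜 := ℝ) |>.1 (le_antisymm h3 real_inner_self_nonneg))

/-- The metric projector: `metricProj C x` is the point of `C` nearest to `x`. -/
def metricProj {d : ℕ} (C : ProperCone ℝ (EuclideanSpace ℝ (Fin d)))
    (x : EuclideanSpace ℝ (Fin d)) : EuclideanSpace ℝ (Fin d) :=
  (existsUnique_nearest C x).choose

/-- The face of `C` with outward normal `u`: the points of `C` at which the supremum of `⟪u, ·⟫`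
over `C` is attained. -/
def face {d : ℕ} (C : ProperCone ℝ (EuclideanSpace ℝ (Fin d)))
    (u : EuclideanSpace ℝ (Fin d)) : Set (EuclideanSpace ℝ (Fin d)) :=
  {x | x ∈ C ∧ ∀ y ∈ C, ⟪u, y⟫ ≤ ⟪u, x⟫}

/-- The `k`-th intrinsic volume of a polyhedral cone `C`: the probability that the projection onto
`C` of a standard Gaussian vector lies in the relative interior of a `k`-dimensional face of `C`.
(The affine span of a nonempty face is its linear hull, since the face contains `0`.) -/
def polyhedralIntrinsicVolume {d : ℕ} (C : ProperCone ℝ (EuclideanSpace ℝ (Fin d))) (k : ℕ) : ℝ :=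
  (stdGaussian (EuclideanSpace ℝ (Fin d))).real
    {g | ∃ u : EuclideanSpace ℝ (Fin d),
      Module.finrank ℝ (Submodule.span ℝ (face C u)) = k ∧
      metricProj C g ∈ intrinsicInterior ℝ (face C u)}

open Classical in
/-- The angular distance between two vectors; it is `0` between `0` and `0`, and `π / 2` between
`0` and a nonzero vector. -/
def angularDist {d : ℕ} (x y : EuclideanSpace ℝ (Fin d)) : ℝ :=
  if x = 0 ∧ y = 0 then 0 else InnerProductGeometry.angle x y

/-- The angular expansion of a cone by an angle `α`. -/
def angularExpansion {d : ℕ} (C : ProperCone ℝ (EuclideanSpace ℝ (Fin d))) (α : ℝ) :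
    Set (EuclideanSpace ℝ (Fin d)) :=
  {x | ∃ y ∈ C, angularDist x y ≤ α}

/-- The conic Hausdorff metric. -/
def conicHausdorffDist {d : ℕ} (C₁ C₂ : ProperCone ℝ (EuclideanSpace ℝ (Fin d))) : ℝ :=
  sInf {α : ℝ | 0 ≤ α ∧
    (C₂ : Set (EuclideanSpace ℝ (Fin d))) ⊆ angularExpansion C₁ α ∧
    (C₁ : Set (EuclideanSpace ℝ (Fin d))) ⊆ angularExpansion C₂ α}

/-- The sequence of cones `D` consists of polyhedral cones and converges to `C` in the conic
Hausdorff metric. -/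
def IsPolyhedralApprox {d : ℕ} (D : ℕ → ProperCone ℝ (EuclideanSpace ℝ (Fin d)))
    (C : ProperCone ℝ (EuclideanSpace ℝ (Fin d))) : Prop :=
  (∀ i, IsPolyhedral (D i)) ∧ Tendsto (fun i => conicHausdorffDist (D i) C) atTop (𝓝 0)

/-- The `k`-th conic intrinsic volume of a closed convex cone `C`: the limit of the `k`-th
intrinsic volume of a polyhedral cone `D`, as `D` tends to `C` in the conic Hausdorff metric. -/
def intrinsicVolume {d : ℕ} (C : ProperCone ℝ (EuclideanSpace ℝ (Fin d))) (k : ℕ) : ℝ :=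
  limUnder
    (comap (fun D : ProperCone ℝ (EuclideanSpace ℝ (Fin d)) => conicHausdorffDist D C) (𝓝 0) ⊓
      𝓟 {D | IsPolyhedral D})
    (fun D => polyhedralIntrinsicVolume D k)

/-- The statistical dimension `δ(C) = ∑_{k=0}^d k v_k(C)`. -/
def statDim {d : ℕ} (C : ProperCone ℝ (EuclideanSpace ℝ (Fin d))) : ℝ :=
  ∑ k ∈ Finset.range (d + 1), (k : ℝ) * intrinsicVolume C k

/-- `V` is an intrinsic volume random variable of `C` on the probability space `(Ω, P)`:
`P(V = k) = v_k(C)` for `k = 0, …, d`. -/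
def IsIntrinsicVolumeRV {d : ℕ} (C : ProperCone ℝ (EuclideanSpace ℝ (Fin d)))
    {Ω : Type*} [MeasurableSpace Ω] (P : Measure Ω) (V : Ω → ℕ) : Prop :=
  Measurable V ∧ ∀ k ≤ d, P.real {ω | V ω = k} = intrinsicVolume C k

end

end ConicGeometry

/-! Let `Π` be the projection onto `C` and `g` a standard Gaussian vector. The discrete variable
`V_C` is compared with the continuous variable `‖Π g‖²`.

For polyhedral `C`, cut the space according to which constraints are active at `Π x`. On the piece
belonging to a `k`-dimensional face with linear hull `L`, the splitting `x = Π x + (x - Π x)` is the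
one along `L` and `Lᗮ`, and the piece is invariant under rescaling `L` by `a > 0` and `Lᗮ` by `b >
0`. A linear change of variables, of determinant `a ^ k * b ^ (d - k)`, gives a Steiner formula: the
joint Laplace transform of `‖Π g‖²` and `‖g - Π g‖²` is `∑ v_k a⁻ᵏ b⁻⁽ᵈ⁻ᵏ⁾`
(`integrable_and_integral_exp_eq_sum`).

This identity serves three purposes. The transform is continuous in the cone for `a, b ≥ 1`, and
finitely many of its values determine the `v_k` by interpolation, so the limits defining `v_k` exist
(`tendsto_polyhedralIntrinsicVolume`). Exchanging `a` and `b` is passing to the polar cone by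
Moreau's decomposition, so `v_k(C°) = v_{d-k}(C)`. Derivatives at the origin give `E ‖Π g‖² = E V`
and `E ‖Π g‖⁴ = E [V (V + 2)]`, hence `Var ‖Π g‖² = Var V + 2 δ` (`moments_norm_metricProj_sq`).

Finally, `‖Π x‖²` has gradient `2 Π x`, so the Gaussian Poincaré inequality gives `Var ‖Π g‖² ≤ 4 E
‖Π g‖² = 4 δ`, that is, `Var V ≤ 2 δ`. The bound passes to limits of polyhedral cones. Applied to
`C°`, whose intrinsic volume variable is distributed as `d - V_C` and so has the same variance, it
yields the other half of the minimum. -/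

namespace ConicGeometry

/-! ### The standard Gaussian measure: density, integration by parts, rotation invariance -/

section Gaussian

variable {E : Type*} [NormedAddCommGroup E] [InnerProductSpace ℝ E]

/-- The Lebesgue density of the standard Gaussian measure. -/
noncomputable def gaussianDensity (x : E) : ℝ :=
  (2 * Real.pi) ^ (-(Module.finrank ℝ E / 2 : ℝ)) * Real.exp (-(‖x‖ ^ 2) / 2)

lemma gaussianDensity_nonneg (x : E) : 0 ≤ gaussianDensity x := by
  unfold gaussianDensity; positivity

lemma continuous_gaussianDensity : Continuous (gaussianDensity : E → ℝ) := by
  unfold gaussianDensity; fun_prop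

lemma hasFDerivAt_gaussianDensity (x : E) :
    HasFDerivAt gaussianDensity (-(gaussianDensity x) • innerSL ℝ x) x := by
  unfold gaussianDensity
  have h1 : HasFDerivAt (fun x : E => ‖x‖ ^ 2) (2 • innerSL ℝ x) x :=
    (hasStrictFDerivAt_norm_sq x).hasFDerivAt
  have h2 : HasFDerivAt (fun x : E => -(‖x‖ ^ 2) / 2) (-(innerSL ℝ x)) x := by
    have := h1.const_mul (-(1 / 2) : ℝ)
    convert! this using 1
    · ext y; ring
    · ext y; simp
  have h3 := (h2.exp).const_mul ((2 * Real.pi) ^ (-(Module.finrank ℝ E / 2 : ℝ)) : ℝ)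
  convert! h3 using 1
  ext y
  simp
  ring

variable [FiniteDimensional ℝ E] [MeasurableSpace E] [BorelSpace E]

lemma integrable_gaussianDensity : Integrable (gaussianDensity : E → ℝ) := by
  have h := GaussianFourier.integrable_cexp_neg_mul_sq_norm_add (V := E) (b := 1 / 2) (by norm_num) 0 0
  refine Integrable.const_mul ?_ _
  refine h.norm.congr (Eventually.of_forall fun x => ?_)
  simp only [Complex.norm_exp]
  congr 1
  simp [← Complex.ofReal_pow]
  ring

/-- Both sides are finite measures with the same characteristic function, by the Fourier transform
of `exp (-‖x‖² / 2)`. -/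
lemma stdGaussian_eq_withDensity :
    stdGaussian E = volume.withDensity (fun x => ENNReal.ofReal (gaussianDensity x)) := by
  have : IsFiniteMeasure
      ((volume : Measure E).withDensity (fun x => ENNReal.ofReal (gaussianDensity x))) :=
    isFiniteMeasure_withDensity_ofReal integrable_gaussianDensity.2
  refine Measure.ext_of_charFun (funext fun t => ?_)
  rw [charFun_stdGaussian, charFun_apply,
    integral_withDensity_eq_integral_toReal_smul
      continuous_gaussianDensity.measurable.ennreal_ofReal (by simp)]
  have h := GaussianFourier.integral_cexp_neg_mul_sq_norm_add (V := E) (b := 1 / 2) (by norm_num)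
    Complex.I t
  have h2 : ∀ x : E, (ENNReal.ofReal (gaussianDensity x)).toReal • Complex.exp (⟪x, t⟫ * Complex.I)
      = (((2 * Real.pi) ^ (-(Module.finrank ℝ E / 2 : ℝ)) : ℝ) : ℂ) *
        Complex.exp (-(1 / 2) * ‖x‖ ^ 2 + Complex.I * ⟪t, x⟫) := by
    intro x
    rw [ENNReal.toReal_ofReal (gaussianDensity_nonneg x), gaussianDensity, Complex.real_smul,
      Complex.ofReal_mul, mul_assoc, Complex.ofReal_exp, ← Complex.exp_add, real_inner_comm]
    push_cast
    ring_nf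
  simp_rw [h2]
  rw [integral_const_mul, h, ← mul_assoc]
  have h3 : (((2 * Real.pi) ^ (-(Module.finrank ℝ E / 2 : ℝ)) : ℝ) : ℂ) *
      (Real.pi / (1 / 2)) ^ (Module.finrank ℝ E / 2 : ℂ) = 1 := by
    have : (Real.pi / (1 / 2) : ℂ) = ((2 * Real.pi : ℝ) : ℂ) := by push_cast; ring
    rw [this]
    have h4 : (Module.finrank ℝ E / 2 : ℂ) = ((Module.finrank ℝ E / 2 : ℝ) : ℂ) := by push_cast; ring
    rw [h4, ← Complex.ofReal_cpow (by positivity), ← Complex.ofReal_mul,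
      ← Real.rpow_add (by positivity)]
    simp
  rw [h3, one_mul]
  congr 1
  simp
  ring

lemma integral_stdGaussian (f : E → ℝ) :
    ∫ x, f x ∂stdGaussian E = ∫ x, gaussianDensity x * f x := by
  rw [stdGaussian_eq_withDensity, integral_withDensity_eq_integral_toReal_smul
      continuous_gaussianDensity.measurable.ennreal_ofReal (by simp)]
  simp [ENNReal.toReal_ofReal (gaussianDensity_nonneg _)]

lemma integrable_stdGaussian_iff (f : E → ℝ) :
    Integrable f (stdGaussian E) ↔ Integrable (fun x => gaussianDensity x * f x) := by
  rw [stdGaussian_eq_withDensity, integrable_withDensity_iff_integrable_smul'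
      continuous_gaussianDensity.measurable.ennreal_ofReal (by simp)]
  simp [ENNReal.toReal_ofReal (gaussianDensity_nonneg _)]

/-- Gaussian integration by parts. -/
lemma integral_mul_inner_stdGaussian {f : E → ℝ} {G : E → E}
    (hf : ∀ x, HasGradientAt f (G x) x) (v : E) (h1 : Integrable f (stdGaussian E))
    (h2 : Integrable (fun x => f x * ⟪v, x⟫) (stdGaussian E))
    (h3 : Integrable (fun x => ⟪v, G x⟫) (stdGaussian E)) :
    ∫ x, f x * ⟪v, x⟫ ∂stdGaussian E = ∫ x, ⟪v, G x⟫ ∂stdGaussian E := by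
  rw [integrable_stdGaussian_iff] at h1 h2 h3
  rw [integral_stdGaussian, integral_stdGaussian]
  have key := integral_bilinear_hasFDerivAt_right_eq_neg_left_of_integrable (μ := (volume : Measure E))
    (f := f) (f' := fun x => InnerProductSpace.toDual ℝ E (G x)) (g := gaussianDensity)
    (g' := fun x => (-(gaussianDensity x) • innerSL ℝ x)) (v := v)
    (B := ContinuousLinearMap.mul ℝ ℝ) ?_ ?_ ?_ (fun x _ => (hf x).hasFDerivAt)
    (fun x _ => hasFDerivAt_gaussianDensity x)
  · simp only [ContinuousLinearMap.mul_apply', InnerProductSpace.toDual_apply_apply,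
      FunLike.coe_smul, Pi.smul_apply, innerSL_apply_apply, smul_eq_mul] at key
    have e1 : ∀ x : E, f x * (-gaussianDensity x * ⟪x, v⟫) = -(gaussianDensity x * (f x * ⟪v, x⟫)) := by
      intro x; rw [real_inner_comm]; ring
    have e2 : ∀ x : E, ⟪G x, v⟫ * gaussianDensity x = gaussianDensity x * ⟪v, G x⟫ := by
      intro x; rw [real_inner_comm]; ring
    simp_rw [e1, e2, integral_neg] at key
    exact neg_injective key
  · refine h3.congr (Eventually.of_forall fun x => ?_)
    simp [real_inner_comm]; ring
  · refine h2.neg.congr (Eventually.of_forall fun x => ?_)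
    simp [real_inner_comm]; ring
  · refine h1.congr (Eventually.of_forall fun x => ?_)
    simp; ring

lemma integrable_one_add_norm_pow (n : ℕ) :
    Integrable (fun x : E => (1 + ‖x‖) ^ n) (stdGaussian E) := by
  have h : MemLp (fun x : E => 1 + ‖x‖) n (stdGaussian E) := by
    have h1 : MemLp (fun x : E => ‖x‖) n (stdGaussian E) :=
      MemLp.norm (f := fun x : E => x) (IsGaussian.memLp_id (stdGaussian E) n (by simp))
    exact MemLp.add (memLp_const (1 : ℝ)) h1
  refine h.integrable_norm_pow'.congr (Eventually.of_forall fun x => ?_)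
  simp only [Real.norm_eq_abs]
  rw [abs_of_nonneg (by positivity)]

lemma integrable_of_norm_le_pow {f : E → ℝ} (hf : Continuous f) {K : ℝ} {n : ℕ}
    (h : ∀ x, |f x| ≤ K * (1 + ‖x‖) ^ n) : Integrable f (stdGaussian E) :=
  ((integrable_one_add_norm_pow n).const_mul K).mono' hf.aestronglyMeasurable
    (Eventually.of_forall h)

lemma integrable_prod_of_norm_le_pow {f : E × E → ℝ} (hf : Continuous f) {K : ℝ} {n : ℕ}
    (h : ∀ z, |f z| ≤ K * ((1 + ‖z.1‖) * (1 + ‖z.2‖)) ^ n) :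
    Integrable f ((stdGaussian E).prod (stdGaussian E)) := by
  have h1 := ((integrable_one_add_norm_pow (E := E) n).mul_prod
    (integrable_one_add_norm_pow (E := E) n)).const_mul K
  refine h1.mono' hf.aestronglyMeasurable (Eventually.of_forall fun z => ?_)
  simpa [mul_pow] using h z

/-- The product of two centred copies of the Gaussian measure is invariant under rotations mixing
the two factors; this drives the proof of the Poincaré inequality. -/
lemma integral_comp_rotation {f : E × E → ℝ} (hf : Continuous f) (θ : ℝ) :
    ∫ z, f (ContinuousLinearMap.rotation θ z) ∂(stdGaussian E).prod (stdGaussian E) =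
      ∫ z, f z ∂(stdGaussian E).prod (stdGaussian E) := by
  have h := IsGaussian.map_rotation_eq_self_of_forall_strongDual_eq_zero
    (integral_strongDual_stdGaussian (E := E)) θ
  conv_rhs => rw [← h]
  rw [integral_map (by fun_prop) hf.aestronglyMeasurable]

end Gaussian

lemma one_add_norm_fst_le_mul {F : Type*} [SeminormedAddCommGroup F] (z : F × F) :
    1 + ‖z.1‖ ≤ (1 + ‖z.1‖) * (1 + ‖z.2‖) := by
  have h4 := mul_nonneg (norm_nonneg z.1) (norm_nonneg z.2)
  linarith [norm_nonneg z.1, norm_nonneg z.2]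

lemma one_add_norm_snd_le_mul {F : Type*} [SeminormedAddCommGroup F] (z : F × F) :
    1 + ‖z.2‖ ≤ (1 + ‖z.1‖) * (1 + ‖z.2‖) := by
  have h4 := mul_nonneg (norm_nonneg z.1) (norm_nonneg z.2)
  linarith [norm_nonneg z.1, norm_nonneg z.2]

/-! ### The Gaussian Poincaré inequality, by rotating between two independent copies -/

section Poincare

variable {E : Type*} [NormedAddCommGroup E] [InnerProductSpace ℝ E]

lemma one_add_norm_rotation_fst_le (θ : ℝ) (z : E × E) :
    1 + ‖(ContinuousLinearMap.rotation θ z).1‖ ≤ (1 + ‖z.1‖) * (1 + ‖z.2‖) := by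
  rw [ContinuousLinearMap.rotation_apply]
  have h1 := norm_add_le (Real.cos θ • z.1) (Real.sin θ • z.2)
  rw [norm_smul, norm_smul, Real.norm_eq_abs, Real.norm_eq_abs] at h1
  have h2 := mul_le_of_le_one_left (norm_nonneg z.1) (Real.abs_cos_le_one θ)
  have h3 := mul_le_of_le_one_left (norm_nonneg z.2) (Real.abs_sin_le_one θ)
  have h4 := mul_nonneg (norm_nonneg z.1) (norm_nonneg z.2)
  simp only
  linarith

lemma one_add_norm_rotation_snd_le (θ : ℝ) (z : E × E) :
    1 + ‖(ContinuousLinearMap.rotation θ z).2‖ ≤ (1 + ‖z.1‖) * (1 + ‖z.2‖) := by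
  rw [ContinuousLinearMap.rotation_apply]
  have h1 := norm_add_le (-Real.sin θ • z.1) (Real.cos θ • z.2)
  rw [norm_smul, norm_smul, Real.norm_eq_abs, Real.norm_eq_abs, abs_neg] at h1
  have h2 := mul_le_of_le_one_left (norm_nonneg z.2) (Real.abs_cos_le_one θ)
  have h3 := mul_le_of_le_one_left (norm_nonneg z.1) (Real.abs_sin_le_one θ)
  have h4 := mul_nonneg (norm_nonneg z.1) (norm_nonneg z.2)
  simp only
  linarith

lemma rotation_rotation_neg (θ : ℝ) (z : E × E) :
    ContinuousLinearMap.rotation θ (ContinuousLinearMap.rotation (-θ) z) = z := by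
  have h := Real.cos_sq_add_sin_sq θ
  simp only [ContinuousLinearMap.rotation_apply, Real.cos_neg, Real.sin_neg]
  ext1
  · have : Real.cos θ • (Real.cos θ • z.1 + -Real.sin θ • z.2) +
        Real.sin θ • (- -Real.sin θ • z.1 + Real.cos θ • z.2) =
        (Real.cos θ ^ 2 + Real.sin θ ^ 2) • z.1 := by module
    simp only [this, h, one_smul]
  · have : -Real.sin θ • (Real.cos θ • z.1 + -Real.sin θ • z.2) +
        Real.cos θ • (- -Real.sin θ • z.1 + Real.cos θ • z.2) =
        (Real.cos θ ^ 2 + Real.sin θ ^ 2) • z.2 := by module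
    simp only [this, h, one_smul]

lemma hasDerivAt_rotation_fst (θ : ℝ) (z : E × E) :
    HasDerivAt (fun t => (ContinuousLinearMap.rotation t z).1)
      (ContinuousLinearMap.rotation θ z).2 θ := by
  simp only [ContinuousLinearMap.rotation_apply]
  exact ((Real.hasDerivAt_cos θ).smul_const z.1).add ((Real.hasDerivAt_sin θ).smul_const z.2)

variable {f : E → ℝ} {G : E → E} {K : ℝ} {n : ℕ}

lemma abs_mul_inner_rotation_le (hK : 0 ≤ K) (hfK : ∀ x, |f x| ≤ K * (1 + ‖x‖) ^ n)
    (hGK : ∀ x, ‖G x‖ ≤ K * (1 + ‖x‖) ^ n) (z : E × E) {a b c : E}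
    (ha : 1 + ‖a‖ ≤ (1 + ‖z.1‖) * (1 + ‖z.2‖)) (hb : 1 + ‖b‖ ≤ (1 + ‖z.1‖) * (1 + ‖z.2‖))
    (hc : 1 + ‖c‖ ≤ (1 + ‖z.1‖) * (1 + ‖z.2‖)) :
    |f a * ⟪G b, c⟫| ≤ K ^ 2 * ((1 + ‖z.1‖) * (1 + ‖z.2‖)) ^ (n + n + 1) := by
  set w := (1 + ‖z.1‖) * (1 + ‖z.2‖)
  rw [abs_mul]
  have h1 : |f a| ≤ K * w ^ n := (hfK a).trans (by gcongr)
  have h2 : ‖G b‖ ≤ K * w ^ n := (hGK b).trans (by gcongr)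
  have h3 : ‖c‖ ≤ w := by linarith
  calc |f a| * |⟪G b, c⟫| ≤ |f a| * (‖G b‖ * ‖c‖) := by gcongr; exact abs_real_inner_le_norm _ _
    _ ≤ (K * w ^ n) * ((K * w ^ n) * w) := by gcongr
    _ = _ := by ring

lemma continuous_of_hasGradientAt [CompleteSpace E]
    (hf : ∀ x, HasGradientAt f (G x) x) : Continuous f :=
  continuous_iff_continuousAt.2 fun x => (hf x).hasFDerivAt.continuousAt

variable [FiniteDimensional ℝ E] [MeasurableSpace E] [BorelSpace E]

/-- Differentiation under the integral: the polynomial growth bounds dominate the derivative by an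
integrable function that does not depend on the angle. -/
lemma hasDerivAt_integral_mul_rotation (hf : ∀ x, HasGradientAt f (G x) x) (hG : Continuous G)
    (hK : 0 ≤ K) (hfK : ∀ x, |f x| ≤ K * (1 + ‖x‖) ^ n)
    (hGK : ∀ x, ‖G x‖ ≤ K * (1 + ‖x‖) ^ n) (θ : ℝ) :
    HasDerivAt (fun t => ∫ z, f z.1 * f (ContinuousLinearMap.rotation t z).1
        ∂(stdGaussian E).prod (stdGaussian E))
      (∫ z, f z.1 * ⟪G (ContinuousLinearMap.rotation θ z).1,
        (ContinuousLinearMap.rotation θ z).2⟫ ∂(stdGaussian E).prod (stdGaussian E)) θ := by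
  have hfc := continuous_of_hasGradientAt hf
  refine (hasDerivAt_integral_of_dominated_loc_of_deriv_le (s := Set.univ)
    (F := fun t z => f z.1 * f (ContinuousLinearMap.rotation t z).1)
    (F' := fun t z => f z.1 * ⟪G (ContinuousLinearMap.rotation t z).1,
        (ContinuousLinearMap.rotation t z).2⟫)
    (bound := fun z => K ^ 2 * ((1 + ‖z.1‖) * (1 + ‖z.2‖)) ^ (n + n + 1))
    univ_mem ?_ ?_ ?_ ?_ ?_ ?_).2
  · exact Eventually.of_forall fun t => (by fun_prop : Continuous _).aestronglyMeasurable
  · refine integrable_prod_of_norm_le_pow (K := K * K) (n := n + n) (by fun_prop) fun z => ?_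
    rw [abs_mul, pow_add]
    calc |f z.1| * |f (ContinuousLinearMap.rotation θ z).1|
      ≤ (K * (1 + ‖z.1‖) ^ n) * (K * (1 + ‖(ContinuousLinearMap.rotation θ z).1‖) ^ n) := by
          gcongr <;> apply hfK
      _ ≤ (K * ((1 + ‖z.1‖) * (1 + ‖z.2‖)) ^ n) * (K * ((1 + ‖z.1‖) * (1 + ‖z.2‖)) ^ n) := by
          gcongr
          · exact one_add_norm_fst_le_mul z
          · exact one_add_norm_rotation_fst_le θ z
      _ = _ := by ring
  · exact (by fun_prop : Continuous _).aestronglyMeasurable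
  · refine Eventually.of_forall fun z t _ => ?_
    exact abs_mul_inner_rotation_le hK hfK hGK z (one_add_norm_fst_le_mul z)
      (one_add_norm_rotation_fst_le t z) (one_add_norm_rotation_snd_le t z)
  · refine integrable_prod_of_norm_le_pow (K := K ^ 2) (n := n + n + 1) (by fun_prop) fun z => ?_
    rw [abs_of_nonneg (by positivity)]
  · refine Eventually.of_forall fun z t _ => ?_
    have h := (hf (ContinuousLinearMap.rotation t z).1).hasFDerivAt.comp_hasDerivAt t
      (hasDerivAt_rotation_fst t z)
    simpa using h.const_mul (f z.1)

/-- Rotating by `-θ` turns the inner product into `⟪G z.1, z.2⟫`. For fixed `z.1 = x`, integration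
by parts in `y = z.2` in the direction `G x` differentiates `f (cos θ • x - sin θ • y)`, which
produces the factor `-sin θ`. -/
lemma integral_mul_inner_rotation (hf : ∀ x, HasGradientAt f (G x) x) (hG : Continuous G)
    (hK : 0 ≤ K) (hfK : ∀ x, |f x| ≤ K * (1 + ‖x‖) ^ n)
    (hGK : ∀ x, ‖G x‖ ≤ K * (1 + ‖x‖) ^ n) (θ : ℝ) :
    ∫ z, f z.1 * ⟪G (ContinuousLinearMap.rotation θ z).1,
        (ContinuousLinearMap.rotation θ z).2⟫ ∂(stdGaussian E).prod (stdGaussian E) =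
      -Real.sin θ * ∫ z, ⟪G z.1, G (ContinuousLinearMap.rotation (-θ) z).1⟫
        ∂(stdGaussian E).prod (stdGaussian E) := by
  have hfc := continuous_of_hasGradientAt hf
  have hI1 : Integrable (fun z : E × E => f (ContinuousLinearMap.rotation (-θ) z).1 * ⟪G z.1, z.2⟫)
      ((stdGaussian E).prod (stdGaussian E)) :=
    integrable_prod_of_norm_le_pow (K := K ^ 2) (n := n + n + 1) (by fun_prop) fun z =>
      abs_mul_inner_rotation_le hK hfK hGK z (one_add_norm_rotation_fst_le _ z)
        (one_add_norm_fst_le_mul z) (one_add_norm_snd_le_mul z)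
  have hI2 : Integrable (fun z : E × E =>
      -Real.sin θ * ⟪G z.1, G (ContinuousLinearMap.rotation (-θ) z).1⟫)
      ((stdGaussian E).prod (stdGaussian E)) := by
    refine Integrable.const_mul ?_ _
    refine integrable_prod_of_norm_le_pow (K := K * K) (n := n + n) (by fun_prop) fun z => ?_
    calc |⟪G z.1, G (ContinuousLinearMap.rotation (-θ) z).1⟫|
      ≤ ‖G z.1‖ * ‖G (ContinuousLinearMap.rotation (-θ) z).1‖ := abs_real_inner_le_norm _ _
      _ ≤ (K * (1 + ‖z.1‖) ^ n) * (K * (1 + ‖(ContinuousLinearMap.rotation (-θ) z).1‖) ^ n) := by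
          gcongr <;> apply hGK
      _ ≤ (K * ((1 + ‖z.1‖) * (1 + ‖z.2‖)) ^ n) * (K * ((1 + ‖z.1‖) * (1 + ‖z.2‖)) ^ n) := by
          gcongr
          · exact one_add_norm_fst_le_mul z
          · exact one_add_norm_rotation_fst_le _ z
      _ = _ := by ring
  rw [← integral_comp_rotation (by fun_prop) (-θ)]
  simp only [rotation_rotation_neg]
  rw [← integral_const_mul, integral_prod _ hI1, integral_prod _ hI2]
  congr 1
  funext x
  have hgrad : ∀ y, HasGradientAt (fun y => f (ContinuousLinearMap.rotation (-θ) (x, y)).1)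
      (-Real.sin θ • G (ContinuousLinearMap.rotation (-θ) (x, y)).1) y := by
    intro y
    rw [hasGradientAt_iff_hasFDerivAt]
    have h1 : HasFDerivAt (fun y => (ContinuousLinearMap.rotation (-θ) (x, y)).1)
        (-Real.sin θ • ContinuousLinearMap.id ℝ E) y := by
      simp only [ContinuousLinearMap.rotation_apply, Real.sin_neg]
      exact ((hasFDerivAt_id y).const_smul _).const_add _
    have h2 := (hf (ContinuousLinearMap.rotation (-θ) (x, y)).1).hasFDerivAt.comp y h1
    convert! h2 using 1
    ext v
    simp
  have hw : ∀ y : E, 1 + ‖(ContinuousLinearMap.rotation (-θ) (x, y)).1‖ ≤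
      (1 + ‖x‖) * (1 + ‖y‖) := fun y => one_add_norm_rotation_fst_le _ (x, y)
  have key := integral_mul_inner_stdGaussian hgrad (G x) ?_ ?_ ?_
  · rw [key]
    simp [inner_smul_right]
  · refine integrable_of_norm_le_pow (K := K * (1 + ‖x‖) ^ n) (n := n) (by fun_prop) fun y => ?_
    calc _ ≤ K * (1 + ‖(ContinuousLinearMap.rotation (-θ) (x, y)).1‖) ^ n := hfK _
      _ ≤ K * ((1 + ‖x‖) * (1 + ‖y‖)) ^ n := by gcongr; exact hw y
      _ = _ := by rw [mul_pow]; ring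
  · refine integrable_of_norm_le_pow (K := K ^ 2 * (1 + ‖x‖) ^ (n + n + 1)) (n := n + n + 1)
      (by fun_prop) fun y => ?_
    rw [mul_assoc, ← mul_pow]
    exact abs_mul_inner_rotation_le hK hfK hGK (x, y) (hw y) (one_add_norm_fst_le_mul (x, y))
        (one_add_norm_snd_le_mul (x, y))
  · refine integrable_of_norm_le_pow (K := ‖G x‖ * (K * (1 + ‖x‖) ^ n)) (n := n)
      (by fun_prop) fun y => ?_
    rw [inner_smul_right, abs_mul, abs_neg]
    calc _ ≤ 1 * (‖G x‖ * ‖G (ContinuousLinearMap.rotation (-θ) (x, y)).1‖) := by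
          gcongr
          · exact Real.abs_sin_le_one θ
          · exact abs_real_inner_le_norm _ _
      _ ≤ 1 * (‖G x‖ * (K * ((1 + ‖x‖) * (1 + ‖y‖)) ^ n)) := by
          gcongr
          exact (hGK _).trans (by gcongr; exact hw y)
      _ = _ := by rw [mul_pow]; ring

/-- Both arguments of `G` have the standard Gaussian law, so `|⟪a, b⟫| ≤ (‖a‖² + ‖b‖²) / 2`
suffices. -/
lemma abs_integral_inner_rotation_le (hG : Continuous G)
    (hGK : ∀ x, ‖G x‖ ≤ K * (1 + ‖x‖) ^ n) (θ : ℝ) :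
    |∫ z, ⟪G z.1, G (ContinuousLinearMap.rotation θ z).1⟫
        ∂(stdGaussian E).prod (stdGaussian E)| ≤ ∫ x, ‖G x‖ ^ 2 ∂stdGaussian E := by
  have hI : Integrable (fun x : E => ‖G x‖ ^ 2) (stdGaussian E) := by
    refine integrable_of_norm_le_pow (K := K ^ 2) (n := n * 2) (by fun_prop) fun y => ?_
    rw [abs_of_nonneg (by positivity), pow_mul, ← mul_pow]
    gcongr
    exact hGK y
  have hI1 : Integrable (fun z : E × E => ‖G z.1‖ ^ 2) ((stdGaussian E).prod (stdGaussian E)) :=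
    hI.comp_fst _
  have hrot : (((stdGaussian E).prod (stdGaussian E)).map (ContinuousLinearMap.rotation θ)) =
      (stdGaussian E).prod (stdGaussian E) :=
    IsGaussian.map_rotation_eq_self_of_forall_strongDual_eq_zero
      (integral_strongDual_stdGaussian (E := E)) θ
  have hI2 : Integrable (fun z : E × E => ‖G (ContinuousLinearMap.rotation θ z).1‖ ^ 2)
      ((stdGaussian E).prod (stdGaussian E)) := by
    rw [← hrot] at hI1
    exact (integrable_map_measure (by fun_prop) (by fun_prop)).1 hI1
  have e1 : ∫ z, ‖G z.1‖ ^ 2 ∂(stdGaussian E).prod (stdGaussian E) =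
      ∫ x, ‖G x‖ ^ 2 ∂stdGaussian E := by
    rw [integral_fun_fst (fun x => ‖G x‖ ^ 2)]
    simp
  have e2 : ∫ z, ‖G (ContinuousLinearMap.rotation θ z).1‖ ^ 2
      ∂(stdGaussian E).prod (stdGaussian E) = ∫ x, ‖G x‖ ^ 2 ∂stdGaussian E := by
    rw [← e1]
    exact integral_comp_rotation (f := fun z : E × E => ‖G z.1‖ ^ 2) (by fun_prop) θ
  have e3 : ∫ z, (2⁻¹ * ‖G z.1‖ ^ 2 + 2⁻¹ * ‖G (ContinuousLinearMap.rotation θ z).1‖ ^ 2)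
      ∂(stdGaussian E).prod (stdGaussian E) = ∫ x, ‖G x‖ ^ 2 ∂stdGaussian E := by
    rw [integral_add (hI1.const_mul _) (hI2.const_mul _), integral_const_mul, integral_const_mul,
      e1, e2]
    ring
  rw [← e3, ← Real.norm_eq_abs]
  refine norm_integral_le_of_norm_le ((hI1.const_mul _).add (hI2.const_mul _))
    (Eventually.of_forall fun z => ?_)
  have h1 := norm_inner_le_norm (𝕜 := ℝ) (G z.1) (G (ContinuousLinearMap.rotation θ z).1)
  nlinarith [sq_nonneg (‖G z.1‖ - ‖G (ContinuousLinearMap.rotation θ z).1‖)]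

/-- The Gaussian Poincaré inequality. -/
theorem gaussian_poincare (hf : ∀ x, HasGradientAt f (G x) x) (hG : Continuous G)
    (hfK : ∀ x, |f x| ≤ K * (1 + ‖x‖) ^ n) (hGK : ∀ x, ‖G x‖ ≤ K * (1 + ‖x‖) ^ n) :
    ∫ x, f x ^ 2 ∂stdGaussian E - (∫ x, f x ∂stdGaussian E) ^ 2 ≤
      ∫ x, ‖G x‖ ^ 2 ∂stdGaussian E := by
  have hK : 0 ≤ K := by simpa using (abs_nonneg _).trans (hfK 0)
  set M := ∫ x, ‖G x‖ ^ 2 ∂stdGaussian E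
  -- `φ` interpolates between `E f²` at angle `0` and, by independence, `(E f)²` at angle `π / 2`.
  set φ : ℝ → ℝ := fun t => ∫ z, f z.1 * f (ContinuousLinearMap.rotation t z).1
        ∂(stdGaussian E).prod (stdGaussian E) with hφ
  have hφ' := hasDerivAt_integral_mul_rotation hf hG hK hfK hGK
  have h0 : φ 0 = ∫ x, f x ^ 2 ∂stdGaussian E := by
    simp only [hφ, ContinuousLinearMap.rotation_apply, Real.cos_zero, Real.sin_zero, one_smul,
      zero_smul, add_zero, ← sq]
    rw [integral_fun_fst (fun x => f x ^ 2)]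
    simp
  have h1 : φ (Real.pi / 2) = (∫ x, f x ∂stdGaussian E) ^ 2 := by
    simp only [hφ, ContinuousLinearMap.rotation_apply, Real.cos_pi_div_two, Real.sin_pi_div_two,
      one_smul, zero_smul, zero_add]
    rw [integral_prod_mul, sq]
  have hd : ∀ t, HasDerivAt (fun t => φ t - M * Real.cos t)
      (-Real.sin t * (∫ z, ⟪G z.1, G (ContinuousLinearMap.rotation (-t) z).1⟫
        ∂(stdGaussian E).prod (stdGaussian E)) - M * -Real.sin t) t := fun t => by
    have := (hφ' t).sub ((Real.hasDerivAt_cos t).const_mul M)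
    rwa [integral_mul_inner_rotation hf hG hK hfK hGK] at this
  -- Since `φ' t ≥ -M sin t` on this interval, subtracting `M cos t` leaves a nondecreasing
  -- function; its endpoint values give the inequality.
  have hmono : MonotoneOn (fun t => φ t - M * Real.cos t) (Set.Icc 0 (Real.pi / 2)) := by
    refine monotoneOn_of_deriv_nonneg (convex_Icc _ _)
      (fun t _ => (hd t).continuousAt.continuousWithinAt)
      (fun t _ => (hd t).differentiableAt.differentiableWithinAt) fun t ht => ?_
    rw [interior_Icc] at ht
    rw [(hd t).deriv]
    have hs : 0 ≤ Real.sin t := Real.sin_nonneg_of_nonneg_of_le_pi ht.1.le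
      (ht.2.le.trans (by linarith [Real.pi_pos]))
    have := (abs_le.1 (abs_integral_inner_rotation_le hG hGK (-t))).2
    nlinarith [mul_nonneg hs (sub_nonneg.2 this)]
  have hpi : 0 ≤ Real.pi / 2 := by positivity
  have := hmono (Set.left_mem_Icc.2 hpi) (Set.right_mem_Icc.2 hpi) hpi
  simp only [h0, h1, Real.cos_zero, Real.cos_pi_div_two] at this
  linarith

end Poincare

/-! ### Metric projection onto a cone: Moreau's decomposition and the gradient of `‖Π x‖²` -/

section MetricProjection

variable {d : ℕ} (C : ProperCone ℝ (EuclideanSpace ℝ (Fin d))) (x y : EuclideanSpace ℝ (Fin d))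

lemma metricProj_mem : metricProj C x ∈ C := (existsUnique_nearest C x).choose_spec.1.1

lemma norm_sub_metricProj_le {z : EuclideanSpace ℝ (Fin d)} (hz : z ∈ C) :
    ‖x - metricProj C x‖ ≤ ‖x - z‖ := (existsUnique_nearest C x).choose_spec.1.2 z hz

lemma inner_sub_metricProj_sub_nonpos {w : EuclideanSpace ℝ (Fin d)} (hw : w ∈ C) :
    ⟪x - metricProj C x, w - metricProj C x⟫ ≤ 0 := by
  have hconv : Convex ℝ (C : Set (EuclideanSpace ℝ (Fin d))) := by
    intro a ha b hb s t hs ht _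
    exact add_mem (C.smul_mem ha hs) (C.smul_mem hb ht)
  refine (norm_eq_iInf_iff_real_inner_le_zero hconv (metricProj_mem C x)).1
    (le_antisymm ?_ ?_) w hw
  · have : Nonempty (C : Set (EuclideanSpace ℝ (Fin d))) := ⟨⟨w, hw⟩⟩
    exact le_ciInf fun w => norm_sub_metricProj_le C x w.2
  · exact ciInf_le (f := fun w : (C : Set (EuclideanSpace ℝ (Fin d))) => ‖x - w‖)
      ⟨0, Set.forall_mem_range.2 fun _ => norm_nonneg _⟩ ⟨_, metricProj_mem C x⟩

lemma inner_sub_metricProj_self : ⟪x - metricProj C x, metricProj C x⟫ = 0 := by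
  -- The variational inequality is tested at `0` and at twice the projection, both in the cone.
  have h1 := inner_sub_metricProj_sub_nonpos C x (zero_mem C)
  have h2 := inner_sub_metricProj_sub_nonpos C x
    (add_mem (metricProj_mem C x) (metricProj_mem C x))
  rw [add_sub_cancel_right] at h2
  rw [zero_sub, inner_neg_right] at h1
  linarith

lemma inner_sub_metricProj_nonpos {w : EuclideanSpace ℝ (Fin d)} (hw : w ∈ C) :
    ⟪x - metricProj C x, w⟫ ≤ 0 := by
  have h1 := inner_sub_metricProj_sub_nonpos C x hw
  rw [inner_sub_right, inner_sub_metricProj_self] at h1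
  linarith

variable {C x} in
lemma metricProj_eq_of_inner {p : EuclideanSpace ℝ (Fin d)} (hp : p ∈ C) (h0 : ⟪x - p, p⟫ = 0)
    (h : ∀ w ∈ C, ⟪x - p, w⟫ ≤ 0) : metricProj C x = p := by
  refine (existsUnique_nearest C x).unique (existsUnique_nearest C x).choose_spec.1 ⟨hp, ?_⟩
  intro z hz
  refine abs_le_of_sq_le_sq' ?_ (norm_nonneg _) |>.2
  have e : x - z = (x - p) - (z - p) := by abel
  rw [e, norm_sub_sq_real (x - p), inner_sub_right, h0]
  nlinarith [h z hz, sq_nonneg ‖z - p‖]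

lemma norm_metricProj_sq_add : ‖metricProj C x‖ ^ 2 + ‖x - metricProj C x‖ ^ 2 = ‖x‖ ^ 2 := by
  have h := norm_add_sq_real (x - metricProj C x) (metricProj C x)
  rw [inner_sub_metricProj_self, sub_add_cancel] at h
  linarith

lemma norm_metricProj_le : ‖metricProj C x‖ ≤ ‖x‖ := by
  refine abs_le_of_sq_le_sq' ?_ (norm_nonneg _) |>.2
  nlinarith [norm_metricProj_sq_add C x, sq_nonneg ‖x - metricProj C x‖]

lemma inner_metricProj_self : ⟪x, metricProj C x⟫ = ‖metricProj C x‖ ^ 2 := by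
  have h := inner_sub_metricProj_self C x
  rw [inner_sub_left, real_inner_self_eq_norm_sq] at h
  linarith

/-- Moreau's decomposition. -/
lemma metricProj_polarCone : metricProj (polarCone C) x = x - metricProj C x := by
  refine metricProj_eq_of_inner ?_ ?_ ?_
  · rw [mem_polarCone]
    exact fun w hw => inner_sub_metricProj_nonpos C x hw
  · rw [sub_sub_cancel, real_inner_comm, inner_sub_metricProj_self]
  · intro w hw
    rw [sub_sub_cancel, real_inner_comm]
    exact (mem_polarCone C w).1 hw _ (metricProj_mem C x)

lemma norm_metricProj_sub_le : ‖metricProj C x - metricProj C y‖ ≤ ‖x - y‖ := by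
  have h1 := inner_sub_metricProj_sub_nonpos C x (metricProj_mem C y)
  have h2 := inner_sub_metricProj_sub_nonpos C y (metricProj_mem C x)
  set p := metricProj C x
  set q := metricProj C y
  have h3 : ‖p - q‖ ^ 2 ≤ ⟪x - y, p - q⟫ := by
    have e : ⟪x - y, p - q⟫ = ⟪p - q, p - q⟫ - ⟪x - p, q - p⟫ - ⟪y - q, p - q⟫ := by
      simp only [inner_sub_left, inner_sub_right]; ring
    rw [e, real_inner_self_eq_norm_sq]
    linarith
  have h4 := real_inner_le_norm (x - y) (p - q)
  by_contra! hlt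
  nlinarith [norm_nonneg (x - y), norm_nonneg (p - q)]

lemma continuous_metricProj : Continuous (metricProj C) :=
  (LipschitzWith.of_dist_le_mul (K := 1) fun x y => by
    simpa [dist_eq_norm] using norm_metricProj_sub_le C x y).continuous

/-- Thus `‖Π x‖²` is the maximum over `c ∈ C` of functions affine in `x`, attained at `c = Π x`. -/
lemma two_inner_sub_norm_sq_le {c : EuclideanSpace ℝ (Fin d)} (hc : c ∈ C) :
    2 * ⟪x, c⟫ - ‖c‖ ^ 2 ≤ ‖metricProj C x‖ ^ 2 := by
  have h1 := inner_sub_metricProj_nonpos C x hc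
  have h2 := sq_nonneg ‖c - metricProj C x‖
  rw [@norm_sub_sq_real, real_inner_comm] at h2
  rw [inner_sub_left] at h1
  linarith

/-- The first-order remainder lies between `0` and `2 ‖y - x‖²`: testing the maximum formula at `y`
with `Π x` gives the lower bound, and at `x` with `Π y`, together with the nonexpansiveness of `Π`,
the upper one. -/
lemma hasGradientAt_norm_metricProj_sq :
    HasGradientAt (fun x => ‖metricProj C x‖ ^ 2) ((2 : ℝ) • metricProj C x) x := by
  rw [hasGradientAt_iff_hasFDerivAt, hasFDerivAt_iff_isLittleO]
  refine (Asymptotics.IsBigO.of_bound 2 (Eventually.of_forall fun y => ?_)).trans_isLittleO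
    (g := fun y => ‖y - x‖ ^ 2) ?_
  · have h1 := two_inner_sub_norm_sq_le C y (metricProj_mem C x)
    have h2 := two_inner_sub_norm_sq_le C x (metricProj_mem C y)
    have h3 := inner_metricProj_self C x
    have h4 := inner_metricProj_self C y
    have h5 := real_inner_le_norm (y - x) (metricProj C y - metricProj C x)
    have h6 := norm_metricProj_sub_le C y x
    have h7 : ‖y - x‖ * ‖metricProj C y - metricProj C x‖ ≤ ‖y - x‖ * ‖y - x‖ := by gcongr
    simp only [InnerProductSpace.toDual_apply_apply, inner_smul_left, Real.norm_eq_abs,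
      RCLike.conj_to_real, inner_sub_right, inner_sub_left] at *
    rw [real_inner_comm x, real_inner_comm y, abs_of_nonneg (by linarith),
      abs_of_nonneg (by positivity)]
    linarith
  · have := (Asymptotics.isLittleO_norm_pow_norm_pow (E' := EuclideanSpace ℝ (Fin d))
      (show 1 < 2 by norm_num)).comp_tendsto (tendsto_sub_nhds_zero_iff.2 (tendsto_id (x := 𝓝 x)))
    simpa [Function.comp_def] using this.norm_right

end MetricProjection

/-! ### The conic Hausdorff metric and polyhedral approximation -/

section Hausdorff

variable {d : ℕ} {C D : ProperCone ℝ (EuclideanSpace ℝ (Fin d))}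

lemma conicHausdorffDist_le {α : ℝ} (hα : 0 ≤ α)
    (h1 : (D : Set (EuclideanSpace ℝ (Fin d))) ⊆ angularExpansion C α)
    (h2 : (C : Set (EuclideanSpace ℝ (Fin d))) ⊆ angularExpansion D α) :
    conicHausdorffDist C D ≤ α :=
  csInf_le ⟨0, fun _ h => h.1⟩ ⟨hα, h1, h2⟩

lemma conicHausdorffDist_nonneg : 0 ≤ conicHausdorffDist C D :=
  Real.sInf_nonneg fun _ h => h.1

/-- This shows that the infimum in `conicHausdorffDist` runs over a nonempty set, so it is not a
default value. -/
lemma angularExpansion_pi : angularExpansion C Real.pi = Set.univ := by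
  refine Set.eq_univ_of_forall fun x => ⟨0, zero_mem C, ?_⟩
  unfold angularDist
  split_ifs
  · positivity
  · exact InnerProductGeometry.angle_le_pi _ _

lemma exists_of_conicHausdorffDist_lt {α : ℝ} (h : conicHausdorffDist C D < α) :
    ∃ β, 0 ≤ β ∧ β < α ∧ (D : Set (EuclideanSpace ℝ (Fin d))) ⊆ angularExpansion C β ∧
      (C : Set (EuclideanSpace ℝ (Fin d))) ⊆ angularExpansion D β := by
  unfold conicHausdorffDist at h
  obtain ⟨β, hβ, hlt⟩ := exists_lt_of_csInf_lt (by
    exact ⟨Real.pi, Real.pi_pos.le, by simp [angularExpansion_pi],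
      by simp [angularExpansion_pi]⟩) h
  exact ⟨β, hβ.1, hlt, hβ.2⟩

lemma exists_norm_sub_le_of_mem_angularExpansion {p : EuclideanSpace ℝ (Fin d)} {α : ℝ}
    (hα : α < Real.pi / 2) (hp : p ∈ angularExpansion C α) :
    ∃ z ∈ C, ‖p - z‖ ≤ α * ‖p‖ := by
  obtain ⟨y, hy, hle⟩ := hp
  by_cases hp0 : p = 0
  · exact ⟨0, zero_mem C, by simp [hp0]⟩
  rw [angularDist, if_neg (fun h => hp0 h.1)] at hle
  have hy0 : y ≠ 0 := by
    rintro rfl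
    rw [InnerProductGeometry.angle_zero_right] at hle
    linarith
  have hy1 : 0 < ‖y‖ := norm_pos_iff.2 hy0
  set a := InnerProductGeometry.angle p y
  have ha0 : 0 ≤ a := InnerProductGeometry.angle_nonneg _ _
  have hin : Real.cos a * (‖p‖ * ‖y‖) = ⟪p, y⟫ :=
    InnerProductGeometry.cos_angle_mul_norm_mul_norm p y
  have hcos : 0 ≤ Real.cos a := Real.cos_nonneg_of_neg_pi_div_two_le_of_le (by linarith) (by linarith)
  -- The orthogonal projection of `p` onto the ray through `y`; its distance from `p` is `sin a *
  -- ‖p‖`.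
  refine ⟨(Real.cos a * ‖p‖ / ‖y‖) • y, C.smul_mem hy (by positivity), ?_⟩
  have h1 : ‖p - (Real.cos a * ‖p‖ / ‖y‖) • y‖ ^ 2 = (Real.sin a * ‖p‖) ^ 2 := by
    rw [@norm_sub_sq_real, inner_smul_right, ← hin, norm_smul, Real.norm_eq_abs, mul_pow, sq_abs,
      mul_pow, Real.sin_sq]
    field_simp
    ring
  have h2 : Real.sin a ≤ a := Real.sin_le ha0
  have h3 : 0 ≤ Real.sin a := InnerProductGeometry.sin_angle_nonneg p y
  rw [sq_eq_sq₀ (norm_nonneg _) (by positivity)] at h1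
  rw [h1]
  gcongr
  exact h2.trans hle

lemma norm_sub_metricProj_le_add {α : ℝ} (hα0 : 0 ≤ α) (hα : α < Real.pi / 2)
    (h : (C : Set (EuclideanSpace ℝ (Fin d))) ⊆ angularExpansion D α)
    (x : EuclideanSpace ℝ (Fin d)) :
    ‖x - metricProj D x‖ ≤ ‖x - metricProj C x‖ + α * ‖x‖ := by
  obtain ⟨z, hz, hle⟩ := exists_norm_sub_le_of_mem_angularExpansion hα (h (metricProj_mem C x))
  calc ‖x - metricProj D x‖ ≤ ‖x - z‖ := norm_sub_metricProj_le D x hz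
    _ = ‖(x - metricProj C x) + (metricProj C x - z)‖ := by congr 1; abel
    _ ≤ ‖x - metricProj C x‖ + ‖metricProj C x - z‖ := norm_add_le _ _
    _ ≤ ‖x - metricProj C x‖ + α * ‖metricProj C x‖ := by gcongr
    _ ≤ ‖x - metricProj C x‖ + α * ‖x‖ := by gcongr; exact norm_metricProj_le C x

lemma tendsto_norm_sub_metricProj (C : ProperCone ℝ (EuclideanSpace ℝ (Fin d)))
    (x : EuclideanSpace ℝ (Fin d)) :
    Tendsto (fun D => ‖x - metricProj D x‖) (comap (fun D => conicHausdorffDist D C) (𝓝 0))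
      (𝓝 ‖x - metricProj C x‖) := by
  rw [Metric.tendsto_nhds]
  intro ε hε
  -- The cap `1` keeps the angle below `π / 2`.
  set α := min 1 (ε / (‖x‖ + 1))
  have hα : 0 < α := by positivity
  have hε' : α * ‖x‖ < ε := by
    calc α * ‖x‖ < α * (‖x‖ + 1) := by gcongr; linarith
      _ ≤ ε / (‖x‖ + 1) * (‖x‖ + 1) := by gcongr; exact min_le_right _ _
      _ = ε := by field_simp
  filter_upwards [preimage_mem_comap (Iio_mem_nhds hα)] with D hD
  obtain ⟨β, hβ0, hβ, h1, h2⟩ := exists_of_conicHausdorffDist_lt hD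
  have hpi : β < Real.pi / 2 := by
    linarith [min_le_left 1 (ε / (‖x‖ + 1)), Real.pi_gt_three]
  have h3 := norm_sub_metricProj_le_add hβ0 hpi h1 x
  have h4 := norm_sub_metricProj_le_add hβ0 hpi h2 x
  have h5 : β * ‖x‖ ≤ α * ‖x‖ := by gcongr
  rw [Real.dist_eq, abs_lt]
  constructor <;> linarith

lemma tendsto_norm_metricProj_sq (C : ProperCone ℝ (EuclideanSpace ℝ (Fin d)))
    (x : EuclideanSpace ℝ (Fin d)) :
    Tendsto (fun D => ‖metricProj D x‖ ^ 2) (comap (fun D => conicHausdorffDist D C) (𝓝 0))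
      (𝓝 (‖metricProj C x‖ ^ 2)) := by
  have h : ∀ D : ProperCone ℝ (EuclideanSpace ℝ (Fin d)),
      ‖metricProj D x‖ ^ 2 = ‖x‖ ^ 2 - ‖x - metricProj D x‖ ^ 2 := fun D => by
    rw [← norm_metricProj_sq_add D x]; ring
  simp_rw [h]
  exact ((tendsto_norm_sub_metricProj C x).pow 2).const_sub _

/-- The unit vectors with `‖Π x‖ ≤ cos α` form a compact set. Each is cut off by the halfspace with
normal `Π x - x`, which contains `C`. Finitely many such halfspaces cut off the whole set, and their
intersection is the required cone. -/
lemma exists_isPolyhedral_conicHausdorffDist_le (C : ProperCone ℝ (EuclideanSpace ℝ (Fin d)))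
    {α : ℝ} (hα0 : 0 < α) (hα : α < Real.pi / 2) :
    ∃ D, IsPolyhedral D ∧ conicHausdorffDist D C ≤ α := by
  have hcos1 : Real.cos α < 1 := by
    rw [← Real.cos_zero]
    exact Real.cos_lt_cos_of_nonneg_of_le_pi_div_two le_rfl hα.le hα0
  have hcos0 : 0 < Real.cos α := Real.cos_pos_of_mem_Ioo ⟨by linarith, hα⟩
  set K : Set (EuclideanSpace ℝ (Fin d)) :=
    Metric.sphere 0 1 ∩ {x | ‖metricProj C x‖ ≤ Real.cos α}
  have hK : IsCompact K := (isCompact_sphere _ _).inter_right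
    (isClosed_le (continuous_metricProj C).norm continuous_const)
  obtain ⟨t, ht⟩ := hK.elim_finite_subcover
    (fun z : EuclideanSpace ℝ (Fin d) => {x | ⟪metricProj C z - z, x⟫ < 0})
    (fun z => isOpen_lt (by fun_prop) continuous_const) (by
      rintro x ⟨hx1, hx2⟩
      refine Set.mem_iUnion.2 ⟨x, ?_⟩
      have h1 : x - metricProj C x ≠ 0 := by
        intro h
        rw [sub_eq_zero] at h
        rw [Set.mem_ofPred_eq, ← h, mem_sphere_zero_iff_norm.1 hx1] at hx2
        linarith
      have h2 : ⟪metricProj C x - x, x⟫ = -‖x - metricProj C x‖ ^ 2 := by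
        have h3 := inner_sub_metricProj_self C x
        rw [← real_inner_self_eq_norm_sq, inner_sub_right, h3, ← neg_sub x, inner_neg_left]
        ring
      have h4 : 0 < ‖x - metricProj C x‖ := norm_pos_iff.2 h1
      rw [Set.mem_ofPred_eq, h2]
      nlinarith)
  have hDmem : ∀ y, y ∈ ProperCone.innerDual
      ((fun z => metricProj C z - z) '' (t : Set (EuclideanSpace ℝ (Fin d)))) ↔
        ∀ z ∈ t, 0 ≤ ⟪metricProj C z - z, y⟫ := by
    intro y
    simp [ProperCone.mem_innerDual]
  set D := ProperCone.innerDual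
    ((fun z => metricProj C z - z) '' (t : Set (EuclideanSpace ℝ (Fin d))))
  have hCD : ∀ y ∈ C, y ∈ D := fun y hy => (hDmem y).2 fun z _ => by
    have := inner_sub_metricProj_nonpos C z hy
    rw [← neg_sub, inner_neg_left]
    linarith
  refine ⟨D, ⟨t.card, fun i => metricProj C (t.equivFin.symm i) - t.equivFin.symm i, ?_⟩,
    conicHausdorffDist_le hα0.le (fun y hy => ⟨y, hCD y hy, ?_⟩) fun x hx => ?_⟩
  · ext y
    rw [SetLike.mem_coe, hDmem, Set.mem_iInter, t.equivFin.symm.forall_congr_left]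
    simp
  · unfold angularDist
    split_ifs with h
    · exact hα0.le
    · rw [InnerProductGeometry.angle_self (fun h0 => h ⟨h0, h0⟩)]
      exact hα0.le
  · by_cases hx0 : x = 0
    · exact ⟨0, zero_mem C, by simp [angularDist, hx0, hα0.le]⟩
    have hxn : 0 < ‖x‖ := norm_pos_iff.2 hx0
    set x' := ‖x‖⁻¹ • x with hx'
    have hn : ‖x'‖ = 1 := by rw [hx', norm_smul, norm_inv, norm_norm, inv_mul_cancel₀ hxn.ne']
    have hxD : x' ∈ D := D.smul_mem hx (by positivity)
    have hlt : Real.cos α < ‖metricProj C x'‖ := by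
      by_contra! hle
      obtain ⟨z, hz⟩ := Set.mem_iUnion.1 (ht ⟨mem_sphere_zero_iff_norm.2 hn, hle⟩)
      obtain ⟨hz, hz'⟩ := Set.mem_iUnion.1 hz
      exact absurd ((hDmem x').1 hxD z hz) (not_le.2 hz')
    refine ⟨metricProj C x', metricProj_mem C x', ?_⟩
    rw [angularDist, if_neg (fun h => hx0 h.1)]
    have h1 : InnerProductGeometry.angle x (metricProj C x') =
        InnerProductGeometry.angle x' (metricProj C x') :=
      (InnerProductGeometry.angle_smul_left_of_pos _ _ (by positivity)).symm
    -- For a unit vector, the cosine of the angle to its nonzero projection equals the norm of the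
    -- projection.
    rw [h1, InnerProductGeometry.angle, inner_metricProj_self, hn, one_mul, sq,
      mul_div_cancel_right₀ _ (by linarith), ← Real.arccos_cos hα0.le (by linarith)]
    exact Real.arccos_le_arccos hlt.le

/-- The filter of polyhedral cones that tend to `C` in the conic Hausdorff metric. -/
noncomputable def polyhedralNhds (C : ProperCone ℝ (EuclideanSpace ℝ (Fin d))) :
    Filter (ProperCone ℝ (EuclideanSpace ℝ (Fin d))) :=
  comap (fun D => conicHausdorffDist D C) (𝓝 0) ⊓ 𝓟 {D | IsPolyhedral D}

/-- Needed for dominated convergence along this filter. -/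
instance (C : ProperCone ℝ (EuclideanSpace ℝ (Fin d))) : (polyhedralNhds C).IsCountablyGenerated :=
  Filter.Inf.isCountablyGenerated _ _

lemma isPolyhedralApprox_iff_tendsto {D : ℕ → ProperCone ℝ (EuclideanSpace ℝ (Fin d))}
    (hD : ∀ i, IsPolyhedral (D i)) :
    IsPolyhedralApprox D C ↔ Tendsto D atTop (polyhedralNhds C) := by
  rw [polyhedralNhds, tendsto_inf, tendsto_comap_iff, tendsto_principal]
  exact ⟨fun h => ⟨h.2, Eventually.of_forall hD⟩, fun h => ⟨hD, h.1⟩⟩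

lemma exists_isPolyhedralApprox (C : ProperCone ℝ (EuclideanSpace ℝ (Fin d))) :
    ∃ D, IsPolyhedralApprox D C := by
  have h : ∀ n : ℕ, ∃ D, IsPolyhedral D ∧ conicHausdorffDist D C ≤ 1 / ((n : ℝ) + 1) := fun n =>
    exists_isPolyhedral_conicHausdorffDist_le C (by positivity) (by
      have : 1 / ((n : ℝ) + 1) ≤ 1 := by
        rw [div_le_one (by positivity)]; linarith [n.cast_nonneg (α := ℝ)]
      linarith [Real.pi_gt_three])
  choose D hD1 hD2 using h
  exact ⟨D, hD1, squeeze_zero (fun n => conicHausdorffDist_nonneg) hD2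
    tendsto_one_div_add_atTop_nhds_zero_nat⟩

/-- Makes limits along this filter unique. -/
instance (C : ProperCone ℝ (EuclideanSpace ℝ (Fin d))) : (polyhedralNhds C).NeBot := by
  obtain ⟨D, hD⟩ := exists_isPolyhedralApprox C
  exact ((isPolyhedralApprox_iff_tendsto hD.1).1 hD).neBot

end Hausdorff

/-! ### Faces of polyhedral cones and active constraints -/

section Faces

variable {d : ℕ}

lemma exists_pos_add_smul_sub_mem {s : Set (EuclideanSpace ℝ (Fin d))}
    {p x : EuclideanSpace ℝ (Fin d)} (hp : p ∈ intrinsicInterior ℝ s) (hx : x ∈ s) :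
    ∃ ε : ℝ, 0 < ε ∧ p + ε • (p - x) ∈ s := by
  obtain ⟨q, hq, rfl⟩ := mem_intrinsicInterior.1 hp
  have hx' : x ∈ affineSpan ℝ s := subset_affineSpan ℝ s hx
  have hline : ∀ t : ℝ, AffineMap.lineMap (q : EuclideanSpace ℝ (Fin d)) x (-t) ∈ affineSpan ℝ s :=
    fun t => AffineMap.lineMap_mem _ q.2 hx'
  have hc : Continuous (fun t : ℝ => (⟨_, hline t⟩ : affineSpan ℝ s)) :=
    Continuous.subtype_mk (AffineMap.lineMap_continuous.comp continuous_neg) _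
  have h0 : (⟨_, hline 0⟩ : affineSpan ℝ s) = q := by ext1; simp
  have h1 := hc.continuousAt.eventually_mem (x := 0)
    (h0 ▸ mem_interior_iff_mem_nhds.1 hq)
  obtain ⟨ε, hmem, hε⟩ := ((h1.filter_mono nhdsWithin_le_nhds).and
    (self_mem_nhdsWithin (s := Set.Ioi (0 : ℝ)))).exists
  refine ⟨ε, hε, ?_⟩
  have h2 : AffineMap.lineMap (q : EuclideanSpace ℝ (Fin d)) x (-ε) ∈ s := hmem
  rw [AffineMap.lineMap_apply_module'] at h2
  convert! h2 using 1
  module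

/-- A segment from `x` through the relative interior point `p` can be prolonged a little inside the
face. As `⟪v, ·⟫` is maximal at `p`, it cannot be smaller at `x`. -/
lemma face_subset_face {C : ProperCone ℝ (EuclideanSpace ℝ (Fin d))}
    {u v p : EuclideanSpace ℝ (Fin d)} (hu : p ∈ intrinsicInterior ℝ (face C u))
    (hv : p ∈ face C v) : face C u ⊆ face C v := by
  intro x hx
  obtain ⟨ε, hε, hmem⟩ := exists_pos_add_smul_sub_mem hu hx
  have h1 := hv.2 _ hmem.1
  rw [inner_add_right, inner_smul_right, inner_sub_right] at h1
  have h2 : ⟪v, p⟫ ≤ ⟪v, x⟫ := by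
    by_contra! hlt
    nlinarith
  exact ⟨hx.1, fun y hy => (hv.2 y hy).trans h2⟩

lemma face_eq_of_mem_intrinsicInterior {C : ProperCone ℝ (EuclideanSpace ℝ (Fin d))}
    {u v p : EuclideanSpace ℝ (Fin d)} (hu : p ∈ intrinsicInterior ℝ (face C u))
    (hv : p ∈ intrinsicInterior ℝ (face C v)) : face C u = face C v :=
  (face_subset_face hu (intrinsicInterior_subset hv)).antisymm
    (face_subset_face hv (intrinsicInterior_subset hu))

variable {N : ℕ} (u : Fin N → EuclideanSpace ℝ (Fin d))

open Classical in
/-- The indices of the constraints `0 ≤ ⟪u i, ·⟫` that are active at `p`. -/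
noncomputable def activeSet (p : EuclideanSpace ℝ (Fin d)) : Finset (Fin N) :=
  {i | ⟪u i, p⟫ = 0}

/-- The common kernel of the functionals `⟪u i, ·⟫`, `i ∈ I`. -/
def tightSubspace (I : Finset (Fin N)) : Submodule ℝ (EuclideanSpace ℝ (Fin d)) where
  carrier := {x | ∀ i ∈ I, ⟪u i, x⟫ = 0}
  add_mem' hx hy i hi := by rw [inner_add_right, hx i hi, hy i hi, add_zero]
  zero_mem' i _ := inner_zero_right _
  smul_mem' c x hx i hi := by rw [inner_smul_right, hx i hi, mul_zero]

variable {u}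

lemma mem_activeSet {p : EuclideanSpace ℝ (Fin d)} {i : Fin N} :
    i ∈ activeSet u p ↔ ⟪u i, p⟫ = 0 := by simp [activeSet]

lemma mem_tightSubspace_activeSet (p : EuclideanSpace ℝ (Fin d)) :
    p ∈ tightSubspace u (activeSet u p) := fun _ hi => mem_activeSet.1 hi

lemma activeSet_smul {c : ℝ} (hc : c ≠ 0) (p : EuclideanSpace ℝ (Fin d)) :
    activeSet u (c • p) = activeSet u p := by
  ext i
  simp [mem_activeSet, inner_smul_right, hc]

variable {C : ProperCone ℝ (EuclideanSpace ℝ (Fin d))}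
  (hC : (C : Set (EuclideanSpace ℝ (Fin d))) = ⋂ i, {x | 0 ≤ ⟪u i, x⟫})

include hC

lemma mem_iff_forall_inner_nonneg {x : EuclideanSpace ℝ (Fin d)} :
    x ∈ C ↔ ∀ i, 0 ≤ ⟪u i, x⟫ := by
  rw [← SetLike.mem_coe, hC]; simp

/-- The constraints inactive at `p` are strict there and stay so nearby; the active ones vanish on
the subspace. -/
lemma eventually_mem_of_mem_tightSubspace {p : EuclideanSpace ℝ (Fin d)} (hp : p ∈ C) :
    ∀ᶠ w in 𝓝 p, w ∈ tightSubspace u (activeSet u p) → w ∈ C := by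
  rw [mem_iff_forall_inner_nonneg hC] at hp
  have h : ∀ i, ∀ᶠ w in 𝓝 p, w ∈ tightSubspace u (activeSet u p) → 0 ≤ ⟪u i, w⟫ := by
    intro i
    by_cases hi : i ∈ activeSet u p
    · exact Eventually.of_forall fun w hw => (hw i hi).ge
    · have hlt : 0 < ⟪u i, p⟫ := (hp i).lt_of_ne' fun h => hi (mem_activeSet.2 h)
      have hc : ContinuousAt (fun w => ⟪u i, w⟫) p := by fun_prop
      filter_upwards [hc.eventually (lt_mem_nhds hlt)] with w hw _ using hw.le
  filter_upwards [eventually_all.2 h] with w hw hw'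
  exact (mem_iff_forall_inner_nonneg hC).2 fun i => hw i hw'

lemma exists_pos_add_smul_mem {p z : EuclideanSpace ℝ (Fin d)} (hp : p ∈ C)
    (hz : z ∈ tightSubspace u (activeSet u p)) : ∃ ε : ℝ, 0 < ε ∧ p + ε • z ∈ C := by
  have hc : ContinuousAt (fun t : ℝ => p + t • z) 0 := by fun_prop
  have h1 := hc.eventually (by simpa using eventually_mem_of_mem_tightSubspace hC hp)
  obtain ⟨ε, hmem, hε⟩ := ((h1.filter_mono nhdsWithin_le_nhds).and
    (self_mem_nhdsWithin (s := Set.Ioi (0 : ℝ)))).exists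
  exact ⟨ε, hε, hmem (add_mem (mem_tightSubspace_activeSet p) (Submodule.smul_mem _ _ hz))⟩

/-- On `C` this functional is a sum of nonpositive terms, so its maximum `0` is attained exactly
where every term vanishes. -/
lemma face_neg_sum (I : Finset (Fin N)) :
    face C (-∑ i ∈ I, u i) = (C : Set (EuclideanSpace ℝ (Fin d))) ∩ tightSubspace u I := by
  have hsum : ∀ y, ⟪-∑ i ∈ I, u i, y⟫ = -∑ i ∈ I, ⟪u i, y⟫ := fun y => by
    rw [inner_neg_left, sum_inner]
  ext x
  constructor
  · rintro ⟨hx, hmax⟩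
    refine ⟨hx, fun i hi => ?_⟩
    have hnn : ∀ i ∈ I, 0 ≤ ⟪u i, x⟫ := fun i _ => (mem_iff_forall_inner_nonneg hC).1 hx i
    have h0 := hmax 0 (zero_mem C)
    rw [inner_zero_right, hsum] at h0
    exact (Finset.sum_eq_zero_iff_of_nonneg hnn).1
      (le_antisymm (by linarith) (Finset.sum_nonneg hnn)) i hi
  · rintro ⟨hx, hL⟩
    refine ⟨hx, fun y hy => ?_⟩
    rw [hsum, hsum, Finset.sum_eq_zero hL, neg_zero, neg_nonpos]
    exact Finset.sum_nonneg fun i _ => (mem_iff_forall_inner_nonneg hC).1 hy i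

lemma span_inter_tightSubspace {p : EuclideanSpace ℝ (Fin d)} (hp : p ∈ C) :
    Submodule.span ℝ ((C : Set (EuclideanSpace ℝ (Fin d))) ∩ tightSubspace u (activeSet u p)) =
      tightSubspace u (activeSet u p) := by
  refine le_antisymm (Submodule.span_le.2 Set.inter_subset_right) fun z hz => ?_
  obtain ⟨ε, hε, hmem⟩ := exists_pos_add_smul_mem hC hp hz
  have hpL := mem_tightSubspace_activeSet (u := u) p
  have e : z = ε⁻¹ • ((p + ε • z) - p) := by
    rw [add_sub_cancel_left, smul_smul, inv_mul_cancel₀ hε.ne', one_smul]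
  rw [e]
  exact Submodule.smul_mem _ _ (sub_mem
    (Submodule.subset_span ⟨hmem, add_mem hpL (Submodule.smul_mem _ _ hz)⟩)
    (Submodule.subset_span ⟨hp, hpL⟩))

lemma mem_intrinsicInterior_inter_tightSubspace {p : EuclideanSpace ℝ (Fin d)} (hp : p ∈ C) :
    p ∈ intrinsicInterior ℝ
      ((C : Set (EuclideanSpace ℝ (Fin d))) ∩ tightSubspace u (activeSet u p)) := by
  set s := (C : Set (EuclideanSpace ℝ (Fin d))) ∩ tightSubspace u (activeSet u p)
  have hps : p ∈ s := ⟨hp, mem_tightSubspace_activeSet p⟩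
  refine mem_intrinsicInterior.2 ⟨⟨p, subset_affineSpan ℝ s hps⟩, ?_, rfl⟩
  have hle : affineSpan ℝ s ≤ (tightSubspace u (activeSet u p)).toAffineSubspace :=
    affineSpan_le.2 fun x hx => hx.2
  have h := (continuous_subtype_val.continuousAt
    (x := (⟨p, subset_affineSpan ℝ s hps⟩ : affineSpan ℝ s))).eventually
    (eventually_mem_of_mem_tightSubspace hC hp)
  rw [mem_interior_iff_mem_nhds]
  filter_upwards [h] with w hw
  have hwL : (w : EuclideanSpace ℝ (Fin d)) ∈ tightSubspace u (activeSet u p) := hle w.2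
  exact ⟨hw hwL, hwL⟩

/-- Only one face has `p` in its relative interior: the one cut out by the constraints active at
`p`. This replaces the quantifier over normals by a finite combinatorial datum. -/
lemma exists_face_iff_finrank_tightSubspace {p : EuclideanSpace ℝ (Fin d)} (hp : p ∈ C) (k : ℕ) :
    (∃ v, Module.finrank ℝ (Submodule.span ℝ (face C v)) = k ∧
      p ∈ intrinsicInterior ℝ (face C v)) ↔
    Module.finrank ℝ (tightSubspace u (activeSet u p)) = k := by
  have h1 := mem_intrinsicInterior_inter_tightSubspace hC hp
  have h2 := span_inter_tightSubspace hC hp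
  rw [← face_neg_sum hC] at h1 h2
  constructor
  · rintro ⟨v, rfl, hv⟩
    rw [face_eq_of_mem_intrinsicInterior hv h1, h2]
  · rintro rfl
    exact ⟨_, by rw [h2], h1⟩

/-- From `p` one can move a little along both `z` and `-z` inside `C`, so the normal `q` is
orthogonal to `z`. -/
lemma inner_eq_zero_of_mem_tightSubspace {p q z : EuclideanSpace ℝ (Fin d)} (hp : p ∈ C)
    (hq : ∀ w ∈ C, ⟪q, w⟫ ≤ 0) (hqp : ⟪q, p⟫ = 0)
    (hz : z ∈ tightSubspace u (activeSet u p)) : ⟪q, z⟫ = 0 := by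
  have key : ∀ z ∈ tightSubspace u (activeSet u p), ⟪q, z⟫ ≤ 0 := by
    intro z hz
    obtain ⟨ε, hε, hmem⟩ := exists_pos_add_smul_mem hC hp hz
    have h := hq _ hmem
    rw [inner_add_right, hqp, zero_add, inner_smul_right] at h
    exact nonpos_of_mul_nonpos_right h hε
  refine le_antisymm (key z hz) ?_
  have h := key (-z) (neg_mem hz)
  rw [inner_neg_right] at h
  linarith

end Faces

/-! ### Scaling a subspace and its orthogonal complement separately -/

section ScaleSplit

variable {E : Type*} [NormedAddCommGroup E] [InnerProductSpace ℝ E] [FiniteDimensional ℝ E]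

/-- The linear map that acts as multiplication by `a` on `L` and by `b` on `Lᗮ`. -/
noncomputable def scaleSplit (L : Submodule ℝ E) (a b : ℝ) : E →ₗ[ℝ] E :=
  a • (L.starProjection : E →ₗ[ℝ] E) + b • (LinearMap.id - (L.starProjection : E →ₗ[ℝ] E))

lemma scaleSplit_apply_add (L : Submodule ℝ E) (a b : ℝ) {p q : E} (hp : p ∈ L) (hq : q ∈ Lᗮ) :
    scaleSplit L a b (p + q) = a • p + b • q := by
  have h : L.starProjection (p + q) = p :=
    L.eq_starProjection_of_mem_orthogonal hp (by simpa using hq)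
  simp [scaleSplit, h]

lemma det_scaleSplit (L : Submodule ℝ E) (a b : ℝ) :
    LinearMap.det (scaleSplit L a b) =
      a ^ Module.finrank ℝ L * b ^ (Module.finrank ℝ E - Module.finrank ℝ L) := by
  have hcompl := L.isCompl_orthogonal
  set e := L.prodEquivOfIsCompl Lᗮ hcompl
  have h : scaleSplit L a b = (e : (L × Lᗮ) →ₗ[ℝ] E) ∘ₗ
      (LinearMap.prodMap (a • LinearMap.id) (b • LinearMap.id)) ∘ₗ (e.symm : E →ₗ[ℝ] (L × Lᗮ)) := by
    ext x
    obtain ⟨⟨p, q⟩, rfl⟩ := e.surjective x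
    simp [e, scaleSplit_apply_add L a b p.2 q.2]
  rw [h, LinearMap.det_conj, LinearMap.det_prodMap, LinearMap.det_smul, LinearMap.det_smul,
    LinearMap.det_id, LinearMap.det_id, mul_one, mul_one]
  congr 2
  have := L.finrank_add_finrank_orthogonal
  omega

lemma scaleSplit_inv_scaleSplit (L : Submodule ℝ E) {a b : ℝ} (ha : a ≠ 0) (hb : b ≠ 0) (x : E) :
    scaleSplit L a⁻¹ b⁻¹ (scaleSplit L a b x) = x := by
  have hp : L.starProjection x ∈ L := L.starProjection_apply_mem x
  have hq : x - L.starProjection x ∈ Lᗮ := L.sub_starProjection_mem_orthogonal x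
  conv_lhs => rw [← add_sub_cancel (L.starProjection x) x]
  rw [scaleSplit_apply_add L _ _ hp hq,
    scaleSplit_apply_add L _ _ (L.smul_mem _ hp) (Lᗮ.smul_mem _ hq), inv_smul_smul₀ ha,
    inv_smul_smul₀ hb, add_sub_cancel]

end ScaleSplit

/-! ### The conic Steiner formula for polyhedral cones -/

section Steiner

variable {d N : ℕ} (u : Fin N → EuclideanSpace ℝ (Fin d))
  (C : ProperCone ℝ (EuclideanSpace ℝ (Fin d)))

/-- The set of points whose projection onto `C` has the active set `I`. -/
def activeRegion (I : Finset (Fin N)) : Set (EuclideanSpace ℝ (Fin d)) :=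
  {x | activeSet u (metricProj C x) = I}

lemma measurableSet_activeRegion (I : Finset (Fin N)) : MeasurableSet (activeRegion u C I) := by
  have h : activeRegion u C I = ⋂ i, {x | ⟪u i, metricProj C x⟫ = 0 ↔ i ∈ I} := by
    ext x
    simp [activeRegion, Finset.ext_iff, mem_activeSet]
  rw [h]
  refine MeasurableSet.iInter fun i => ?_
  have hc : MeasurableSet {x | ⟪u i, metricProj C x⟫ = 0} :=
    (isClosed_eq (continuous_const.inner (continuous_metricProj C)) continuous_const).measurableSet
  by_cases hi : i ∈ I
  · simpa [hi] using hc
  · convert! hc.compl using 1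
    ext x
    simp [hi]

lemma pairwise_disjoint_activeRegion : Pairwise (Function.onFun Disjoint (activeRegion u C)) := by
  intro I J hIJ
  refine Set.disjoint_left.2 fun x hx hy => hIJ ?_
  rw [← show activeSet u (metricProj C x) = I from hx]
  exact hy

lemma iUnion_activeRegion : ⋃ I, activeRegion u C I = Set.univ :=
  Set.eq_univ_of_forall fun _ => Set.mem_iUnion.2 ⟨_, rfl⟩

variable {u C}
variable (hC : (C : Set (EuclideanSpace ℝ (Fin d))) = ⋂ i, {x | 0 ≤ ⟪u i, x⟫})

include hC

lemma sub_metricProj_mem_orthogonal {I : Finset (Fin N)} {x : EuclideanSpace ℝ (Fin d)}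
    (hx : x ∈ activeRegion u C I) : x - metricProj C x ∈ (tightSubspace u I)ᗮ := by
  rw [Submodule.mem_orthogonal']
  intro z hz
  rw [← show activeSet u (metricProj C x) = I from hx] at hz
  exact inner_eq_zero_of_mem_tightSubspace hC (metricProj_mem C x)
    (fun w hw => inner_sub_metricProj_nonpos C x hw) (inner_sub_metricProj_self C x) hz

lemma scaleSplit_of_mem_activeRegion {I : Finset (Fin N)} {x : EuclideanSpace ℝ (Fin d)}
    (hx : x ∈ activeRegion u C I) (a b : ℝ) :
    scaleSplit (tightSubspace u I) a b x = a • metricProj C x + b • (x - metricProj C x) := by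
  have hp : metricProj C x ∈ tightSubspace u I := by
    rw [← show activeSet u (metricProj C x) = I from hx]
    exact mem_tightSubspace_activeSet _
  conv_lhs => rw [← add_sub_cancel (metricProj C x) x]
  exact scaleSplit_apply_add _ _ _ hp (sub_metricProj_mem_orthogonal hC hx)

/-- Rescaling both Moreau components by positive factors preserves the conditions that characterize
them, and `a • p` has the same active constraints as `p`. -/
lemma scaleSplit_mem_activeRegion {I : Finset (Fin N)} {x : EuclideanSpace ℝ (Fin d)}
    (hx : x ∈ activeRegion u C I) {a b : ℝ} (ha : 0 < a) (hb : 0 < b) :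
    scaleSplit (tightSubspace u I) a b x ∈ activeRegion u C I := by
  have h : metricProj C (scaleSplit (tightSubspace u I) a b x) = a • metricProj C x := by
    rw [scaleSplit_of_mem_activeRegion hC hx]
    refine metricProj_eq_of_inner (C.smul_mem (metricProj_mem C x) ha.le) ?_ fun w hw => ?_
    · rw [add_sub_cancel_left, inner_smul_left, inner_smul_right, inner_sub_metricProj_self,
        mul_zero, mul_zero]
    · rw [add_sub_cancel_left, inner_smul_left]
      exact mul_nonpos_of_nonneg_of_nonpos hb.le (inner_sub_metricProj_nonpos C x hw)
  rw [activeRegion, Set.mem_ofPred_eq, h, activeSet_smul ha.ne']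
  exact hx

lemma scaleSplit_mem_activeRegion_iff {I : Finset (Fin N)} {x : EuclideanSpace ℝ (Fin d)}
    {a b : ℝ} (ha : 0 < a) (hb : 0 < b) :
    scaleSplit (tightSubspace u I) a b x ∈ activeRegion u C I ↔ x ∈ activeRegion u C I := by
  refine ⟨fun h => ?_, fun h => scaleSplit_mem_activeRegion hC h ha hb⟩
  rw [← scaleSplit_inv_scaleSplit (tightSubspace u I) ha.ne' hb.ne' x]
  exact scaleSplit_mem_activeRegion hC h (inv_pos.2 ha) (inv_pos.2 hb)

lemma indicator_gaussianDensity_scaleSplit (I : Finset (Fin N)) {a b : ℝ} (ha : 0 < a)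
    (hb : 0 < b) (x : EuclideanSpace ℝ (Fin d)) :
    (activeRegion u C I).indicator gaussianDensity (scaleSplit (tightSubspace u I) a b x) =
      gaussianDensity x * (activeRegion u C I).indicator
        (fun x => Real.exp (((1 - a ^ 2) * ‖metricProj C x‖ ^ 2 +
          (1 - b ^ 2) * ‖x - metricProj C x‖ ^ 2) / 2)) x := by
  by_cases hx : x ∈ activeRegion u C I
  · rw [Set.indicator_of_mem ((scaleSplit_mem_activeRegion_iff hC ha hb).2 hx),
      Set.indicator_of_mem hx, gaussianDensity, gaussianDensity, mul_assoc, ← Real.exp_add,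
      scaleSplit_of_mem_activeRegion hC hx, ← norm_metricProj_sq_add C x, norm_add_sq_real,
      inner_smul_left, inner_smul_right, real_inner_comm, inner_sub_metricProj_self,
      norm_smul, norm_smul, Real.norm_of_nonneg ha.le, Real.norm_of_nonneg hb.le]
    congr 2
    ring
  · rw [Set.indicator_of_notMem (fun h => hx ((scaleSplit_mem_activeRegion_iff hC ha hb).1 h)),
      Set.indicator_of_notMem hx, mul_zero]

/-- Change of variables by `scaleSplit`: the region is invariant, the exponential is the ratio of
the Gaussian densities at `T x` and `x`, and the constant is the inverse determinant. -/
lemma integrableOn_and_setIntegral_activeRegion (I : Finset (Fin N)) {a b : ℝ} (ha : 0 < a)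
    (hb : 0 < b) :
    IntegrableOn (fun x => Real.exp (((1 - a ^ 2) * ‖metricProj C x‖ ^ 2 +
        (1 - b ^ 2) * ‖x - metricProj C x‖ ^ 2) / 2)) (activeRegion u C I)
      (stdGaussian (EuclideanSpace ℝ (Fin d))) ∧
    ∫ x in activeRegion u C I, Real.exp (((1 - a ^ 2) * ‖metricProj C x‖ ^ 2 +
        (1 - b ^ 2) * ‖x - metricProj C x‖ ^ 2) / 2) ∂stdGaussian (EuclideanSpace ℝ (Fin d)) =
      a⁻¹ ^ Module.finrank ℝ (tightSubspace u I) *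
        b⁻¹ ^ (d - Module.finrank ℝ (tightSubspace u I)) *
        (stdGaussian (EuclideanSpace ℝ (Fin d))).real (activeRegion u C I) := by
  have hA := measurableSet_activeRegion u C I
  set A := activeRegion u C I
  set T := scaleSplit (tightSubspace u I) a b
  have hT : Measurable T := T.continuous_of_finiteDimensional.measurable
  have hdet : LinearMap.det T = a ^ Module.finrank ℝ (tightSubspace u I) *
      b ^ (d - Module.finrank ℝ (tightSubspace u I)) := by
    rw [det_scaleSplit, finrank_euclideanSpace_fin]
  have hdet0 : 0 < LinearMap.det T := by rw [hdet]; positivity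
  have hmap := Measure.map_linearMap_addHaar_eq_smul_addHaar
    (volume : Measure (EuclideanSpace ℝ (Fin d))) hdet0.ne'
  have hint : Integrable (A.indicator gaussianDensity)
      (volume : Measure (EuclideanSpace ℝ (Fin d))) := integrable_gaussianDensity.indicator hA
  have hint' : Integrable (A.indicator gaussianDensity)
      (Measure.map T (volume : Measure (EuclideanSpace ℝ (Fin d)))) := by
    rw [hmap]
    exact hint.smul_measure ENNReal.ofReal_ne_top
  have hcomp := indicator_gaussianDensity_scaleSplit hC I ha hb
  constructor
  · rw [← integrable_indicator_iff hA, integrable_stdGaussian_iff]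
    refine ((integrable_map_measure hint'.aestronglyMeasurable hT.aemeasurable).1 hint').congr ?_
    exact Eventually.of_forall hcomp
  · rw [← integral_indicator hA, integral_stdGaussian]
    refine (integral_congr_ae (Eventually.of_forall fun x => (hcomp x).symm)).trans ?_
    rw [← integral_map hT.aemeasurable hint'.aestronglyMeasurable, hmap, integral_smul_measure,
      ENNReal.toReal_ofReal (abs_nonneg _), abs_of_pos (inv_pos.2 hdet0), hdet, mul_inv, inv_pow,
      inv_pow, smul_eq_mul]
    congr 1
    rw [← integral_indicator_one hA, integral_stdGaussian]
    congr 1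
    funext x
    by_cases hx : x ∈ A <;> simp [hx]

lemma polyhedralIntrinsicVolume_eq_sum (k : ℕ) :
    polyhedralIntrinsicVolume C k =
      ∑ I ∈ {I : Finset (Fin N) | Module.finrank ℝ (tightSubspace u I) = k},
        (stdGaussian (EuclideanSpace ℝ (Fin d))).real (activeRegion u C I) := by
  rw [polyhedralIntrinsicVolume, ← measureReal_biUnion_finset
    (fun I _ J _ hIJ => pairwise_disjoint_activeRegion u C hIJ)
    (fun I _ => measurableSet_activeRegion u C I)]
  congr 1
  ext x
  rw [Set.mem_ofPred_eq, exists_face_iff_finrank_tightSubspace hC (metricProj_mem C x)]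
  simp [activeRegion]

omit hC in
lemma polyhedralIntrinsicVolume_nonneg (k : ℕ) : 0 ≤ polyhedralIntrinsicVolume C k :=
  measureReal_nonneg

omit hC in
/-- The conic Steiner formula, in terms of Laplace transforms. -/
theorem integrable_and_integral_exp_eq_sum (hC : IsPolyhedral C) {a b : ℝ} (ha : 0 < a)
    (hb : 0 < b) :
    Integrable (fun x => Real.exp (((1 - a ^ 2) * ‖metricProj C x‖ ^ 2 +
        (1 - b ^ 2) * ‖x - metricProj C x‖ ^ 2) / 2))
      (stdGaussian (EuclideanSpace ℝ (Fin d))) ∧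
    ∫ x, Real.exp (((1 - a ^ 2) * ‖metricProj C x‖ ^ 2 +
        (1 - b ^ 2) * ‖x - metricProj C x‖ ^ 2) / 2) ∂stdGaussian (EuclideanSpace ℝ (Fin d)) =
      ∑ k ∈ Finset.range (d + 1), polyhedralIntrinsicVolume C k * (a⁻¹ ^ k * b⁻¹ ^ (d - k)) := by
  obtain ⟨N, u, hC⟩ := hC
  have hon := fun I => (integrableOn_and_setIntegral_activeRegion hC I ha hb).1
  constructor
  · rw [← integrableOn_univ, ← iUnion_activeRegion u C, integrableOn_finite_iUnion]
    exact hon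
  · rw [← setIntegral_univ, ← iUnion_activeRegion u C, integral_iUnion_fintype
      (measurableSet_activeRegion u C) (pairwise_disjoint_activeRegion u C) hon]
    simp_rw [(integrableOn_and_setIntegral_activeRegion hC _ ha hb).2,
      polyhedralIntrinsicVolume_eq_sum hC, Finset.sum_mul]
    -- The active sets are grouped by the dimension of their subspaces.
    rw [← Finset.sum_fiberwise_of_maps_to (s := Finset.univ) (t := Finset.range (d + 1))
      (g := fun I => Module.finrank ℝ (tightSubspace u I))]
    · refine Finset.sum_congr rfl fun k _ => Finset.sum_congr rfl fun I hI => ?_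
      rw [(Finset.mem_filter.1 hI).2]
      ring
    · intro I _
      rw [Finset.mem_range, Nat.lt_succ_iff]
      simpa using Submodule.finrank_le (tightSubspace u I)

end Steiner

/-- The coefficients of a polynomial of degree at most `d` are fixed linear combinations of its
values at the points `1, 1/2, …, 1/(d+1)`. -/
lemma exists_coeff_eq_sum_eval (d : ℕ) : ∃ w : ℕ → ℕ → ℝ, ∀ p : ℕ → ℝ, ∀ k ≤ d,
    p k = ∑ j ∈ Finset.range (d + 1),
      w k j * ∑ i ∈ Finset.range (d + 1), p i * ((j + 1 : ℝ)⁻¹) ^ i := by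
  classical
  set s := Finset.range (d + 1)
  set v : ℕ → ℝ := fun j => (j + 1 : ℝ)⁻¹
  have hv : Set.InjOn v s := fun i _ j _ hij => by simpa [v] using hij
  -- The weights are the coefficients of the Lagrange basis polynomials at these nodes.
  refine ⟨fun k j => (Lagrange.basis s v j).coeff k, fun p k hk => ?_⟩
  set q : Polynomial ℝ := ∑ i ∈ s, Polynomial.C (p i) * Polynomial.X ^ i with hq
  have hdeg : q.degree < s.card := by
    rw [Finset.card_range]
    exact (Polynomial.degree_lt_iff_coeff_zero _ _).2 fun m hm => by
      rw [hq, Polynomial.finsetSum_coeff]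
      refine Finset.sum_eq_zero fun i hi => ?_
      rw [Polynomial.coeff_C_mul_X_pow, if_neg]
      have := Finset.mem_range.1 hi
      omega
  have hcoeff : q.coeff k = p k := by
    rw [hq, Polynomial.finsetSum_coeff]
    simp [s, hk]
  rw [← hcoeff, Lagrange.eq_interpolate hv hdeg, Lagrange.interpolate_apply,
    Polynomial.finsetSum_coeff]
  refine Finset.sum_congr rfl fun j _ => ?_
  rw [Polynomial.coeff_C_mul, mul_comm]
  congr 1
  simp [hq, Polynomial.eval_finsetSum, v]

/-! ### Passage to general cones, and duality -/

section Limits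

variable {d : ℕ} (C : ProperCone ℝ (EuclideanSpace ℝ (Fin d)))

/-- The joint Laplace transform of the squared norms of the projections of a standard Gaussian
vector onto `C` and its polar cone. -/
noncomputable def conicLaplace (a b : ℝ) : ℝ :=
  ∫ x, Real.exp (((1 - a ^ 2) * ‖metricProj C x‖ ^ 2 +
    (1 - b ^ 2) * ‖x - metricProj C x‖ ^ 2) / 2) ∂stdGaussian (EuclideanSpace ℝ (Fin d))

lemma conicLaplace_polarCone (a b : ℝ) : conicLaplace (polarCone C) a b = conicLaplace C b a := by
  unfold conicLaplace
  simp_rw [metricProj_polarCone, sub_sub_cancel]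
  congr 1
  funext x
  ring_nf

/-- For `a, b ≥ 1` the exponent is nonpositive, so the constant `1` dominates. -/
lemma tendsto_conicLaplace {a b : ℝ} (ha : 1 ≤ a) (hb : 1 ≤ b) :
    Tendsto (fun D => conicLaplace D a b) (polyhedralNhds C) (𝓝 (conicLaplace C a b)) := by
  refine tendsto_integral_filter_of_dominated_convergence (fun _ => 1) ?_ ?_ (integrable_const _) ?_
  · refine Eventually.of_forall fun D => Continuous.aestronglyMeasurable ?_
    have := continuous_metricProj D
    fun_prop
  · refine Eventually.of_forall fun D => Eventually.of_forall fun x => ?_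
    rw [Real.norm_of_nonneg (Real.exp_nonneg _), Real.exp_le_one_iff]
    have h1 : 0 ≤ (a ^ 2 - 1) * ‖metricProj D x‖ ^ 2 := mul_nonneg (by nlinarith) (sq_nonneg _)
    have h2 : 0 ≤ (b ^ 2 - 1) * ‖x - metricProj D x‖ ^ 2 := mul_nonneg (by nlinarith) (sq_nonneg _)
    linarith
  · refine Eventually.of_forall fun x => (Real.continuous_exp.tendsto _).comp ?_
    have h1 := (tendsto_norm_metricProj_sq C x).mono_left
      (inf_le_left : polyhedralNhds C ≤ _)
    have h2 := ((tendsto_norm_sub_metricProj C x).mono_left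
      (inf_le_left : polyhedralNhds C ≤ _)).pow 2
    exact ((h1.const_mul _).add (h2.const_mul _)).div_const 2

lemma eventually_isPolyhedral : ∀ᶠ D in polyhedralNhds C, IsPolyhedral D :=
  mem_inf_of_right (mem_principal_self _)

lemma conicLaplace_of_isPolyhedral {C : ProperCone ℝ (EuclideanSpace ℝ (Fin d))}
    (hC : IsPolyhedral C) {a b : ℝ} (ha : 0 < a) (hb : 0 < b) :
    conicLaplace C a b =
      ∑ k ∈ Finset.range (d + 1), polyhedralIntrinsicVolume C k * (a⁻¹ ^ k * b⁻¹ ^ (d - k)) :=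
  (integrable_and_integral_exp_eq_sum hC ha hb).2

/-- With `b = 1` the Laplace transform is a polynomial in `a⁻¹` with coefficients `v_k`.
Interpolation at `a = 1, …, d + 1`, all in the range where the transform is continuous in the cone,
shows that the coefficients converge. -/
lemma tendsto_polyhedralIntrinsicVolume {k : ℕ} (hk : k ≤ d) :
    Tendsto (fun D => polyhedralIntrinsicVolume D k) (polyhedralNhds C)
      (𝓝 (intrinsicVolume C k)) := by
  refine tendsto_nhds_limUnder ?_
  obtain ⟨w, hw⟩ := exists_coeff_eq_sum_eval d
  refine ⟨∑ j ∈ Finset.range (d + 1), w k j * conicLaplace C (j + 1) 1, ?_⟩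
  have h : Tendsto (fun D => ∑ j ∈ Finset.range (d + 1), w k j * conicLaplace D (j + 1) 1)
      (polyhedralNhds C)
      (𝓝 (∑ j ∈ Finset.range (d + 1), w k j * conicLaplace C (j + 1) 1)) :=
    tendsto_finsetSum _ fun j _ => (tendsto_conicLaplace C (by simp) le_rfl).const_mul _
  refine h.congr' ?_
  filter_upwards [eventually_isPolyhedral C] with D hD
  rw [hw (polyhedralIntrinsicVolume D) k hk]
  refine Finset.sum_congr rfl fun j _ => ?_
  rw [conicLaplace_of_isPolyhedral hD (by positivity) one_pos]
  simp

lemma conicLaplace_eq_sum {a b : ℝ} (ha : 1 ≤ a) (hb : 1 ≤ b) :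
    conicLaplace C a b =
      ∑ k ∈ Finset.range (d + 1), intrinsicVolume C k * (a⁻¹ ^ k * b⁻¹ ^ (d - k)) := by
  refine tendsto_nhds_unique (tendsto_conicLaplace C ha hb) ?_
  have h : Tendsto (fun D => ∑ k ∈ Finset.range (d + 1),
      polyhedralIntrinsicVolume D k * (a⁻¹ ^ k * b⁻¹ ^ (d - k))) (polyhedralNhds C)
      (𝓝 (∑ k ∈ Finset.range (d + 1), intrinsicVolume C k * (a⁻¹ ^ k * b⁻¹ ^ (d - k)))) :=
    tendsto_finsetSum _ fun k hk => (tendsto_polyhedralIntrinsicVolume C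
      (Nat.lt_succ_iff.1 (Finset.mem_range.1 hk))).mul_const _
  refine h.congr' ?_
  filter_upwards [eventually_isPolyhedral C] with D hD
  rw [conicLaplace_of_isPolyhedral hD (by positivity) (by positivity)]

lemma intrinsicVolume_nonneg {k : ℕ} (hk : k ≤ d) : 0 ≤ intrinsicVolume C k :=
  ge_of_tendsto (tendsto_polyhedralIntrinsicVolume C hk)
    (Eventually.of_forall fun _ => polyhedralIntrinsicVolume_nonneg k)

lemma sum_intrinsicVolume : ∑ k ∈ Finset.range (d + 1), intrinsicVolume C k = 1 := by
  have h := conicLaplace_eq_sum C le_rfl le_rfl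
  simpa [conicLaplace] using h.symm

/-- Polarity exchanges `a` and `b` in the Laplace transform, which reverses the order of the
coefficients; interpolation identifies them. -/
lemma intrinsicVolume_polarCone {k : ℕ} (hk : k ≤ d) :
    intrinsicVolume (polarCone C) k = intrinsicVolume C (d - k) := by
  obtain ⟨w, hw⟩ := exists_coeff_eq_sum_eval d
  rw [hw (intrinsicVolume (polarCone C)) k hk, hw (fun i => intrinsicVolume C (d - i)) k hk]
  refine Finset.sum_congr rfl fun j _ => ?_
  congr 1
  have h1 := conicLaplace_eq_sum (polarCone C) (a := j + 1) (by simp) (le_refl 1)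
  have h2 := conicLaplace_eq_sum C (b := j + 1) (le_refl 1) (by simp)
  rw [conicLaplace_polarCone, h2, ← Finset.sum_range_reflect] at h1
  simp only [inv_one, one_pow, one_mul, mul_one] at h1
  rw [← h1]
  refine Finset.sum_congr rfl fun i hi => ?_
  have hi := Finset.mem_range.1 hi
  rw [show d + 1 - 1 - i = d - i by omega, show d - (d - i) = i by omega]

end Limits

/-! ### Moments of `‖Π g‖²` and the variance bound -/

section Moments

/-- This is the moment generating function of a chi-squared variable with `k` degrees of freedom;
each derivative raises the exponent by `2`. -/
lemma hasDerivAt_inv_sqrt_pow (k : ℕ) {t : ℝ} (ht : t < 1 / 2) :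
    HasDerivAt (fun t => (√(1 - 2 * t))⁻¹ ^ k) (k * (√(1 - 2 * t))⁻¹ ^ (k + 2)) t := by
  have hpos : 0 < 1 - 2 * t := by linarith
  have h1 : HasDerivAt (fun t : ℝ => 1 - 2 * t) (-2) t := by
    simpa using ((hasDerivAt_id t).const_mul 2).const_sub 1
  have hs : 0 < √(1 - 2 * t) := Real.sqrt_pos.2 hpos
  have h2 := ((h1.sqrt hpos.ne').inv hs.ne').pow k
  convert! h2 using 1
  rcases k with _ | k
  · simp
  · simp only [Nat.add_sub_cancel, Pi.inv_apply]
    have e : -(-2 / (2 * √(1 - 2 * t))) / √(1 - 2 * t) ^ 2 = (√(1 - 2 * t))⁻¹ ^ 3 := by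
      field_simp
    rw [e]
    ring

variable {d : ℕ} {C : ProperCone ℝ (EuclideanSpace ℝ (Fin d))}

lemma integrable_exp_and_mgf_norm_metricProj_sq (hC : IsPolyhedral C) {t : ℝ} (ht : t < 1 / 2) :
    t ∈ integrableExpSet (fun x => ‖metricProj C x‖ ^ 2)
      (stdGaussian (EuclideanSpace ℝ (Fin d))) ∧
    mgf (fun x => ‖metricProj C x‖ ^ 2) (stdGaussian (EuclideanSpace ℝ (Fin d))) t =
      ∑ k ∈ Finset.range (d + 1), polyhedralIntrinsicVolume C k * (√(1 - 2 * t))⁻¹ ^ k := by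
  have hpos : 0 < 1 - 2 * t := by linarith
  -- The choice `a = √(1 - 2t)` makes `(1 - a²) / 2 = t`. For `t > 0` this has `a < 1`, so the
  -- polyhedral formula is used, where integrability is known.
  have h := integrable_and_integral_exp_eq_sum hC (Real.sqrt_pos.2 hpos) one_pos
  have e : ∀ x, ((1 - √(1 - 2 * t) ^ 2) * ‖metricProj C x‖ ^ 2 +
      (1 - 1) * ‖x - metricProj C x‖ ^ 2) / 2 = t * ‖metricProj C x‖ ^ 2 := fun x => by
    rw [Real.sq_sqrt hpos.le]; ring
  simp only [inv_one, one_pow, mul_one] at h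
  simp only [e] at h
  exact h

lemma moments_norm_metricProj_sq (hC : IsPolyhedral C) :
    ∫ x, ‖metricProj C x‖ ^ 2 ∂stdGaussian (EuclideanSpace ℝ (Fin d)) =
      ∑ k ∈ Finset.range (d + 1), polyhedralIntrinsicVolume C k * k ∧
    ∫ x, (‖metricProj C x‖ ^ 2) ^ 2 ∂stdGaussian (EuclideanSpace ℝ (Fin d)) =
      ∑ k ∈ Finset.range (d + 1), polyhedralIntrinsicVolume C k * (k * (k + 2)) := by
  set M := mgf (fun x => ‖metricProj C x‖ ^ 2) (stdGaussian (EuclideanSpace ℝ (Fin d)))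
  have hnhds : ∀ {t : ℝ}, t < 1 / 2 → Set.Iio (1 / 2 : ℝ) ∈ 𝓝 t := fun ht => Iio_mem_nhds ht
  have hint : (0 : ℝ) ∈ interior (integrableExpSet (fun x => ‖metricProj C x‖ ^ 2)
      (stdGaussian (EuclideanSpace ℝ (Fin d)))) := by
    rw [mem_interior_iff_mem_nhds]
    filter_upwards [hnhds (t := 0) (by norm_num)] with t ht
    exact (integrable_exp_and_mgf_norm_metricProj_sq hC ht).1
  have hM : ∀ {t : ℝ}, t < 1 / 2 → M =ᶠ[𝓝 t] fun t =>
      ∑ k ∈ Finset.range (d + 1), polyhedralIntrinsicVolume C k * (√(1 - 2 * t))⁻¹ ^ k :=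
    fun ht => by
      filter_upwards [hnhds ht] with s hs
      exact (integrable_exp_and_mgf_norm_metricProj_sq hC hs).2
  have hd1 : ∀ {t : ℝ}, t < 1 / 2 → deriv M t = ∑ k ∈ Finset.range (d + 1),
      polyhedralIntrinsicVolume C k * (k * (√(1 - 2 * t))⁻¹ ^ (k + 2)) := fun ht => by
    rw [(hM ht).deriv_eq]
    exact (HasDerivAt.fun_sum fun k _ => (hasDerivAt_inv_sqrt_pow k ht).const_mul _).deriv
  have hM' : deriv M =ᶠ[𝓝 0] fun t => ∑ k ∈ Finset.range (d + 1),
      polyhedralIntrinsicVolume C k * (k * (√(1 - 2 * t))⁻¹ ^ (k + 2)) := by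
    filter_upwards [hnhds (t := 0) (by norm_num)] with s hs using hd1 hs
  have hd2 : deriv (deriv M) 0 = ∑ k ∈ Finset.range (d + 1),
      polyhedralIntrinsicVolume C k * (k * (k + 2)) := by
    rw [hM'.deriv_eq]
    refine (HasDerivAt.fun_sum fun k _ => ((hasDerivAt_inv_sqrt_pow (k + 2)
      (t := 0) (by norm_num)).const_mul _).const_mul _).deriv.trans ?_
    simp
  constructor
  · rw [← deriv_mgf_zero hint, hd1 (by norm_num)]
    simp
  · have h := iteratedDeriv_mgf_zero hint 2
    rw [iteratedDeriv_succ, iteratedDeriv_one, hd2] at h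
    exact h.symm

/-- The Poincaré inequality with gradient `2 Π x`, whose squared norm is `4 ‖Π x‖²`. -/
lemma variance_norm_metricProj_sq_le (C : ProperCone ℝ (EuclideanSpace ℝ (Fin d))) :
    ∫ x, (‖metricProj C x‖ ^ 2) ^ 2 ∂stdGaussian (EuclideanSpace ℝ (Fin d)) -
      (∫ x, ‖metricProj C x‖ ^ 2 ∂stdGaussian (EuclideanSpace ℝ (Fin d))) ^ 2 ≤
      4 * ∫ x, ‖metricProj C x‖ ^ 2 ∂stdGaussian (EuclideanSpace ℝ (Fin d)) := by
  have hproj := continuous_metricProj C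
  have hc : Continuous fun x => (2 : ℝ) • metricProj C x := by fun_prop
  refine (gaussian_poincare (K := 2) (n := 2) (hasGradientAt_norm_metricProj_sq C)
    hc (fun x => ?_) fun x => ?_).trans_eq ?_
  · rw [abs_of_nonneg (by positivity)]
    nlinarith [norm_metricProj_le C x, norm_nonneg (metricProj C x), norm_nonneg x]
  · rw [norm_smul, Real.norm_of_nonneg (by norm_num)]
    nlinarith [norm_metricProj_le C x, norm_nonneg (metricProj C x), norm_nonneg x]
  · rw [← integral_const_mul]
    congr 1
    funext x
    rw [norm_smul, Real.norm_of_nonneg (by norm_num)]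
    ring

/-- The moment formulas give `Var ‖Π g‖² = Var V + 2 δ` and `E ‖Π g‖² = δ`, so the bound `4 δ`
leaves `2 δ` for `Var V`. -/
lemma polyhedral_variance_le (hC : IsPolyhedral C) :
    ∑ k ∈ Finset.range (d + 1), (k : ℝ) ^ 2 * polyhedralIntrinsicVolume C k -
      (∑ k ∈ Finset.range (d + 1), (k : ℝ) * polyhedralIntrinsicVolume C k) ^ 2 ≤
      2 * ∑ k ∈ Finset.range (d + 1), (k : ℝ) * polyhedralIntrinsicVolume C k := by
  have h := variance_norm_metricProj_sq_le C
  obtain ⟨h1, h2⟩ := moments_norm_metricProj_sq hC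
  have e1 : ∑ k ∈ Finset.range (d + 1), polyhedralIntrinsicVolume C k * (k : ℝ) =
      ∑ k ∈ Finset.range (d + 1), (k : ℝ) * polyhedralIntrinsicVolume C k :=
    Finset.sum_congr rfl fun k _ => mul_comm _ _
  have e2 : ∑ k ∈ Finset.range (d + 1), polyhedralIntrinsicVolume C k * ((k : ℝ) * (k + 2)) =
      ∑ k ∈ Finset.range (d + 1), (k : ℝ) ^ 2 * polyhedralIntrinsicVolume C k +
        2 * ∑ k ∈ Finset.range (d + 1), (k : ℝ) * polyhedralIntrinsicVolume C k := by
    rw [Finset.mul_sum, ← Finset.sum_add_distrib]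
    exact Finset.sum_congr rfl fun k _ => by ring
  rw [h1, h2, e1, e2] at h
  linarith

lemma intrinsicVolume_variance_le_statDim (C : ProperCone ℝ (EuclideanSpace ℝ (Fin d))) :
    ∑ k ∈ Finset.range (d + 1), (k : ℝ) ^ 2 * intrinsicVolume C k - statDim C ^ 2 ≤
      2 * statDim C := by
  have h : ∀ c : ℕ → ℝ, Tendsto
      (fun D => ∑ k ∈ Finset.range (d + 1), c k * polyhedralIntrinsicVolume D k)
      (polyhedralNhds C) (𝓝 (∑ k ∈ Finset.range (d + 1), c k * intrinsicVolume C k)) := fun c =>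
    tendsto_finsetSum _ fun k hk => (tendsto_polyhedralIntrinsicVolume C
      (Nat.lt_succ_iff.1 (Finset.mem_range.1 hk))).const_mul _
  refine le_of_tendsto_of_tendsto ((h _).sub ((h _).pow 2)) ((h _).const_mul 2) ?_
  filter_upwards [eventually_isPolyhedral C] with D hD using polyhedral_variance_le hD

lemma sum_mul_intrinsicVolume_polarCone (C : ProperCone ℝ (EuclideanSpace ℝ (Fin d)))
    (f : ℝ → ℝ) :
    ∑ k ∈ Finset.range (d + 1), f k * intrinsicVolume (polarCone C) k =
      ∑ k ∈ Finset.range (d + 1), f (d - k) * intrinsicVolume C k := by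
  rw [← Finset.sum_range_reflect]
  refine Finset.sum_congr rfl fun k hk => ?_
  have hk' : k ≤ d := Nat.lt_succ_iff.1 (Finset.mem_range.1 hk)
  rw [Nat.add_sub_cancel, intrinsicVolume_polarCone C (Nat.sub_le d k), Nat.sub_sub_self hk',
    Nat.cast_sub hk']

/-- The intrinsic volumes of `C` and of its polar cone have the same variance. -/
lemma variance_polarCone_eq (C : ProperCone ℝ (EuclideanSpace ℝ (Fin d))) :
    ∑ k ∈ Finset.range (d + 1), (k : ℝ) ^ 2 * intrinsicVolume (polarCone C) k -
        statDim (polarCone C) ^ 2 =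
      ∑ k ∈ Finset.range (d + 1), (k : ℝ) ^ 2 * intrinsicVolume C k - statDim C ^ 2 := by
  have h1 : statDim (polarCone C) = d - statDim C := by
    rw [statDim, sum_mul_intrinsicVolume_polarCone C (fun t => t), statDim]
    simp_rw [sub_mul]
    rw [Finset.sum_sub_distrib, ← Finset.mul_sum, sum_intrinsicVolume, mul_one]
  have h2 : ∑ k ∈ Finset.range (d + 1), (k : ℝ) ^ 2 * intrinsicVolume (polarCone C) k =
      d ^ 2 - 2 * d * statDim C +
        ∑ k ∈ Finset.range (d + 1), (k : ℝ) ^ 2 * intrinsicVolume C k := by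
    rw [sum_mul_intrinsicVolume_polarCone C (fun t => t ^ 2), statDim]
    have h3 := sum_intrinsicVolume C
    calc _ = ∑ k ∈ Finset.range (d + 1), ((d : ℝ) ^ 2 * intrinsicVolume C k -
          2 * d * (k * intrinsicVolume C k) + (k : ℝ) ^ 2 * intrinsicVolume C k) :=
          Finset.sum_congr rfl fun k _ => by ring
      _ = _ := by
        rw [Finset.sum_add_distrib, Finset.sum_sub_distrib, ← Finset.mul_sum, ← Finset.mul_sum,
          h3, mul_one]
  rw [h1, h2]
  ring

/-- The law of `V` is prescribed only on `0, …, d`, but those probabilities already sum to `1`. -/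
lemma ae_le_of_isIntrinsicVolumeRV {Ω : Type*} [MeasurableSpace Ω] {P : Measure Ω}
    [IsProbabilityMeasure P] {V : Ω → ℕ} (hV : IsIntrinsicVolumeRV C P V) : ∀ᵐ ω ∂P, V ω ≤ d := by
  have h : P.real {ω | V ω ≤ d} = 1 := by
    have e : {ω | V ω ≤ d} = ⋃ k ∈ Finset.range (d + 1), {ω | V ω = k} := by
      ext ω
      simp
    rw [e, measureReal_biUnion_finset, ← sum_intrinsicVolume C]
    · exact Finset.sum_congr rfl fun k hk => hV.2 k (Nat.lt_succ_iff.1 (Finset.mem_range.1 hk))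
    · exact fun i _ j _ hij => Set.disjoint_left.2 fun ω hi hj => hij (hi.symm.trans hj)
    · exact fun k _ => hV.1 (measurableSet_singleton k)
  rw [measureReal_def, ENNReal.toReal_eq_one_iff] at h
  exact (mem_ae_iff_prob_eq_one (hV.1 measurableSet_Iic)).2 h

lemma integral_comp_of_isIntrinsicVolumeRV {Ω : Type*} [MeasurableSpace Ω] {P : Measure Ω}
    [IsProbabilityMeasure P] {V : Ω → ℕ} (hV : IsIntrinsicVolumeRV C P V) (f : ℕ → ℝ) :
    ∫ ω, f (V ω) ∂P = ∑ k ∈ Finset.range (d + 1), f k * intrinsicVolume C k := by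
  have hm : ∀ k, MeasurableSet {ω | V ω = k} := fun k => hV.1 (measurableSet_singleton k)
  have h : ∀ᵐ ω ∂P, f (V ω) =
      ∑ k ∈ Finset.range (d + 1), {ω | V ω = k}.indicator (fun _ => f k) ω := by
    filter_upwards [ae_le_of_isIntrinsicVolumeRV hV] with ω hω
    simp [Set.indicator_apply, hω]
  rw [integral_congr_ae h, integral_finsetSum _ fun k _ => (integrable_const _).indicator (hm k)]
  refine Finset.sum_congr rfl fun k hk => ?_
  rw [integral_indicator_const _ (hm k), hV.2 k (Nat.lt_succ_iff.1 (Finset.mem_range.1 hk)),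
    smul_eq_mul, mul_comm]

lemma variance_of_isIntrinsicVolumeRV {Ω : Type*} [MeasurableSpace Ω] {P : Measure Ω}
    [IsProbabilityMeasure P] {V : Ω → ℕ} (hV : IsIntrinsicVolumeRV C P V) :
    Var[fun ω => (V ω : ℝ); P] =
      ∑ k ∈ Finset.range (d + 1), (k : ℝ) ^ 2 * intrinsicVolume C k - statDim C ^ 2 := by
  have hmem : MemLp (fun ω => (V ω : ℝ)) 2 P := by
    refine MemLp.of_bound (measurable_from_top.comp hV.1).aestronglyMeasurable d ?_
    filter_upwards [ae_le_of_isIntrinsicVolumeRV hV] with ω hω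
    simpa using hω
  rw [variance_eq_sub hmem, statDim,
    ← integral_comp_of_isIntrinsicVolumeRV hV fun k => (k : ℝ),
    ← integral_comp_of_isIntrinsicVolumeRV hV fun k => (k : ℝ) ^ 2]
  rfl

end Moments

end ConicGeometry

theorem theorem4p5 {d : ℕ} (C : ProperCone ℝ (EuclideanSpace ℝ (Fin d))) :
    -- the intrinsic volumes are well defined, as limits along polyhedral approximations
    (∃ D, ConicGeometry.IsPolyhedralApprox D C) ∧
    (∀ D, ConicGeometry.IsPolyhedralApprox D C → ∀ k ≤ d,
      Tendsto (fun i => ConicGeometry.polyhedralIntrinsicVolume (D i) k) atTop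
        (𝓝 (ConicGeometry.intrinsicVolume C k))) ∧
    -- they form a probability distribution on `{0, …, d}`
    (∀ k ≤ d, 0 ≤ ConicGeometry.intrinsicVolume C k) ∧
    ∑ k ∈ Finset.range (d + 1), ConicGeometry.intrinsicVolume C k = 1 ∧
    -- the variance bound for a random variable with this distribution
    ∀ {Ω : Type*} [MeasurableSpace Ω] (P : Measure Ω) [IsProbabilityMeasure P] (V : Ω → ℕ),
      ConicGeometry.IsIntrinsicVolumeRV C P V →
      Var[fun ω => (V ω : ℝ); P] ≤
        2 * min (ConicGeometry.statDim C)
          (ConicGeometry.statDim (ConicGeometry.polarCone C)) := by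
  refine ⟨ConicGeometry.exists_isPolyhedralApprox C, fun D hD k hk => ?_,
    fun k hk => ConicGeometry.intrinsicVolume_nonneg C hk, ConicGeometry.sum_intrinsicVolume C,
    fun P _ V hV => ?_⟩
  · exact (ConicGeometry.tendsto_polyhedralIntrinsicVolume C hk).comp
      ((ConicGeometry.isPolyhedralApprox_iff_tendsto hD.1).1 hD)
  · rw [ConicGeometry.variance_of_isIntrinsicVolumeRV hV, mul_min_of_nonneg _ _ zero_le_two]
    refine le_min (ConicGeometry.intrinsicVolume_variance_le_statDim C) ?_
    -- The variance is that of the polar cone, to which the one-sided bound applies.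
    rw [← ConicGeometry.variance_polarCone_eq]
    exact ConicGeometry.intrinsicVolume_variance_le_statDim _
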